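/- Let $X$ be a complex Banach space and let $(T(t))_{t\in\mathbb R}$ be a $C_0$-group on $X$, i.e. a family of bounded linear operators on $X$ with $T(0)=I$, $T(t+s)=T(t)T(s)$ for $t,s\in\mathbb R$, and $t\mapsto T(t)x$ continuous for every $x\in X$. Let $(A,D(A))$ be its infinitesimal generator, $Ax=\lim_{t\to0}\frac{T(t)x-x}{t}$, where $D(A)$ is the set of all $x\in X$ for which this limit exists; the powers are taken on their natural domains: $A^0=I$ on $D(A^0)=X$, $D(A^{n+1})=\{x\in D(A^n): A^nx\in D(A)\}$ and $A^{n+1}x=A(A^nx)$. For $n\ge 0$ and $t\in\mathbb R$ let $$H_n(t)=(-1)^ne^{t^2}\frac{d^n}{dt^n}\bigl(e^{-t^2}\bigr),\qquad h_n(t)=\frac{1}{2^nn!\sqrt\pi}\,e^{-t^2}H_n(t),$$ and for $\operatorname{Re}z>0$ and $x\in X$ let $$T^{(g)}(z)x=\frac1{\sqrt{4\pi z}}\int_{-\infty}^{\infty}e^{-t^2/(4z)}\,T(t)x\,dt$$ (principal branch of the square root). These integrals converge absolutely, $T^{(g)}(\tfrac14)x\in D(A^n)$ for all $n\ge0$ and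 $x\in X$, and the following hold. (i) For all $n\ge0$ and $x\in X$, the function $t\mapsto h_n(t)T(t)x$ is integrable on $\mathbb R$ and $$\int_{-\infty}^{\infty}h_n(t)T(t)x\,dt=\frac1{2^nn!}A^nT^{(g)}\bigl(\tfrac14\bigr)x .$$ If $\sup_{t\in\mathbb R}\|T(t)\|<\infty$, then for all $n\ge0$ and $x\in X$ $$\bigl\|A^nT^{(g)}\bigl(\tfrac14\bigr)x\bigr\|\le\Bigl(\sup_{t\in\mathbb R}\|T(t)\|\Bigr)\sqrt{2^nn!}\,\|x\|.$$ (ii) For all $x\in D(A)$ and $t\in\mathbb R$, $$T(t)x=\lim_{m\to\infty}\sum_{n=0}^{m}\frac1{2^nn!}\,A^nT^{(g)}\bigl(\tfrac14\bigr)x\,H_n(t)$$ in the norm of $X$. (iii) If $\sup_{t\in\mathbb R}\|T(t)\|<\infty$, then for all $x\in X$ and $z\in\mathbb C$ with $|z-\tfrac14|<\tfrac14$, $$T^{(g)}(z)x=\sum_{n=0}^{\infty}\frac{1}{2^{2n}n!}\,A^{2n}T^{(g)}\bigl(\tfrac14\bigr)x\,(4z-1)^n,$$ where the series converges unconditionally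 in the norm of $X$. -/

import Mathlib

open Filter Topology MeasureTheory
open scoped Nat

noncomputable section

/-- The Hermite polynomial `H_n` (physicists' normalization), by Rodrigues' formula. -/
def hermiteH (n : ℕ) (t : ℝ) : ℝ :=
  (-1) ^ n * Real.exp (t ^ 2) * iteratedDeriv n (fun s : ℝ => Real.exp (-s ^ 2)) t

/-- The function `h_n(t) = e^{-t²} H_n(t) / (2^n n! √π)`. -/
def hermiteh (n : ℕ) (t : ℝ) : ℝ :=
  1 / (2 ^ n * (n ! : ℝ) * √Real.pi) * Real.exp (-t ^ 2) * hermiteH n t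

/-- The composition `A ∘ B` of partially defined operators, on its natural domain
`{x ∈ D(B) | B x ∈ D(A)}`. -/
def opComp {X : Type*} [AddCommGroup X] [Module ℂ X] (A B : X →ₗ.[ℂ] X) : X →ₗ.[ℂ] X where
  domain := (A.domain.comap B.toFun).map B.domain.subtype
  toFun :=
    { toFun := fun x =>
        A ⟨B ⟨x, by obtain ⟨y, -, hy⟩ := x.2; rw [← hy]; exact y.2⟩, by
          obtain ⟨x, y, hyA, rfl⟩ := x
          exact hyA⟩
      map_add' := fun x y => by
        rw [← A.map_add]
        congr 1
        apply Subtype.ext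
        exact B.map_add ⟨x, by obtain ⟨y, -, hy⟩ := x.2; rw [← hy]; exact y.2⟩
          ⟨y, by obtain ⟨z, -, hz⟩ := y.2; rw [← hz]; exact z.2⟩
      map_smul' := fun c x => by
        rw [RingHom.id_apply, ← A.map_smul]
        congr 1
        apply Subtype.ext
        exact B.map_smul c ⟨x, by obtain ⟨y, -, hy⟩ := x.2; rw [← hy]; exact y.2⟩ }

theorem mem_opComp_domain {X : Type*} [AddCommGroup X] [Module ℂ X] (A B : X →ₗ.[ℂ] X) (x : X) :
    x ∈ (opComp A B).domain ↔ ∃ h : x ∈ B.domain, B ⟨x, h⟩ ∈ A.domain := by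
  constructor
  · rintro ⟨y, hy, rfl⟩
    exact ⟨y.2, hy⟩
  · rintro ⟨h, hA⟩
    exact ⟨⟨x, h⟩, hA, rfl⟩

/-- The powers of a partially defined operator: `A^0 = I` on the whole space and
`A^(n+1) = A ∘ A^n` on its natural domain `D(A^(n+1)) = {x ∈ D(A^n) | A^n x ∈ D(A)}`. -/
def opPow {X : Type*} [AddCommGroup X] [Module ℂ X] (A : X →ₗ.[ℂ] X) : ℕ → (X →ₗ.[ℂ] X)
  | 0 => (LinearMap.id : X →ₗ[ℂ] X).toPMap ⊤
  | n + 1 => opComp A (opPow A n)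

/-- A strongly continuous one-parameter group of bounded linear operators on `X`. -/
structure C0Group (X : Type*) [NormedAddCommGroup X] [NormedSpace ℂ X] where
  /-- the operators `T(t)` -/
  op : ℝ → X →L[ℂ] X
  op_zero : op 0 = ContinuousLinearMap.id ℂ X
  op_add : ∀ t s : ℝ, op (t + s) = (op t).comp (op s)
  continuous_op : ∀ x : X, Continuous fun t : ℝ => op t x

namespace C0Group

variable {X : Type*} [NormedAddCommGroup X] [NormedSpace ℂ X]

/-- `y` is the derivative at `0` of the orbit of `x`: `y = lim_{t → 0} (T(t)x - x)/t`. -/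
def HasGen (T : C0Group X) (x y : X) : Prop :=
  Tendsto (fun t : ℝ => t⁻¹ • (T.op t x - x)) (𝓝[≠] 0) (𝓝 y)

theorem HasGen.add {T : C0Group X} {x y x' y' : X} (h : T.HasGen x y) (h' : T.HasGen x' y') :
    T.HasGen (x + x') (y + y') := by
  refine (Tendsto.add h h').congr fun t => ?_
  rw [map_add, ← smul_add]
  congr 1
  abel

theorem HasGen.smul {T : C0Group X} {x y : X} (c : ℂ) (h : T.HasGen x y) :
    T.HasGen (c • x) (c • y) := by
  refine (Tendsto.const_smul h c).congr fun t => ?_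
  rw [map_smul, ← smul_sub, smul_comm]

theorem HasGen.unique {T : C0Group X} {x y y' : X} (h : T.HasGen x y) (h' : T.HasGen x y') :
    y = y' :=
  tendsto_nhds_unique h h'

/-- The infinitesimal generator `A x = lim_{t → 0} (T(t)x - x)/t`, whose domain is the set of
all `x` for which the limit exists. -/
def generator (T : C0Group X) : X →ₗ.[ℂ] X where
  domain :=
    { carrier := {x | ∃ y, T.HasGen x y}
      add_mem' := fun ⟨_, h⟩ ⟨_, h'⟩ => ⟨_, h.add h'⟩
      zero_mem' := ⟨0, by simp [HasGen]⟩
      smul_mem' := fun c _ ⟨_, h⟩ => ⟨_, h.smul c⟩ }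
  toFun :=
    { toFun := fun x => x.2.choose
      map_add' := fun x y =>
        (x + y).2.choose_spec.unique (x.2.choose_spec.add y.2.choose_spec)
      map_smul' := fun c x => (c • x).2.choose_spec.unique (x.2.choose_spec.smul c) }

theorem hasGen_generator (T : C0Group X) (x : T.generator.domain) :
    T.HasGen x (T.generator x) :=
  x.2.choose_spec

/-- `T^{(g)}(z) x = (4πz)^{-1/2} ∫ e^{-t²/(4z)} T(t)x dt` for `Re z > 0`
(principal branch of the square root). -/
def gauss (T : C0Group X) (z : ℂ) (x : X) : X :=
  ((4 * (Real.pi : ℂ) * z) ^ (1 / 2 : ℂ))⁻¹ •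
    ∫ t : ℝ, Complex.exp (-(t : ℂ) ^ 2 / (4 * z)) • T.op t x

end C0Group

end

/-! Write `I_n = ∫ e^{-t²} H_n(t) T(t)x dt`. At `z = 1/4` the Gaussian mean is `I_0/√π`. Applying
`T(h)` only translates the kernel, and `(e^{-t²} H_n)' = -e^{-t²} H_{n+1}`, so differentiating at `h
= 0` gives `A I_n = I_{n+1}` for every `x` (`hasGen_hermiteIntegral`). Hence `A^n` of the mean is
`I_n/√π`, and (i) follows. The norm bound is Cauchy–Schwarz for the weight `e^{-t²}` and `∫ e^{-t²}
H_n² = 2^n n! √π`.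

By (i), (ii) is pointwise convergence of a vector-valued Hermite expansion at a point `t` of
differentiability. By Christoffel–Darboux the error of the `m`-th partial sum is of order `√m` times
products of a normalized Hermite value at `t` and a Hermite coefficient of the continuous difference
quotient `dslope f t` (`sum_hermite_sub_eq`). The values are `O(m^{-1/4})` by an energy estimate for
the Hermite equation (`abs_hermiteNormalized_le`). The coefficients are `o(m^{-1/4})` by a
Riemann–Lebesgue argument (`tendsto_hermiteRate_mul_norm_hermiteCoeff`): integration by parts for
`C¹` functions, then approximation. So the error tends to zero.

For (iii) put `w = 4z - 1`. The kernels `e^{-t²} H_{2n}` are Fourier integrals of `(2iu)^{2n}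
e^{-u²}`. Summing the exponential series under that integral expands the kernel of `T^{(g)}(z)` in
powers of `w` (`hasSum_hermite_even`). The `L¹` bound behind (i), with `(2n)! ≤ 4^n n!²`, makes the
terms `O(|w|^n)`, so sum and integral commute. -/

noncomputable section

/-! ### Functions of exponential growth -/

/-- `g` grows at most exponentially: `‖g s‖ ≤ K e^{ω|s|}` for some `K, ω ≥ 0`. -/
def ExpGrowth {E : Type*} [NormedAddCommGroup E] (g : ℝ → E) : Prop :=
  ∃ K ω : ℝ, 0 ≤ K ∧ 0 ≤ ω ∧ ∀ s, ‖g s‖ ≤ K * Real.exp (ω * |s|)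

namespace ExpGrowth

variable {E F : Type*} [NormedAddCommGroup E] [NormedAddCommGroup F]

theorem of_le {g : ℝ → E} {f : ℝ → F} (hf : ExpGrowth f) (h : ∀ s, ‖g s‖ ≤ ‖f s‖) :
    ExpGrowth g := by
  obtain ⟨K, ω, hK, hω, hb⟩ := hf
  exact ⟨K, ω, hK, hω, fun s => (h s).trans (hb s)⟩

theorem const (c : E) : ExpGrowth fun _ : ℝ => c :=
  ⟨‖c‖, 0, norm_nonneg _, le_rfl, fun s => by simp⟩

theorem id : ExpGrowth fun s : ℝ => s :=
  ⟨1, 1, zero_le_one, zero_le_one, fun s => by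
    have := Real.add_one_le_exp |s|
    rw [one_mul, one_mul, Real.norm_eq_abs]
    linarith⟩

theorem norm {g : ℝ → E} (hg : ExpGrowth g) : ExpGrowth fun s => ‖g s‖ :=
  hg.of_le fun s => by simp

theorem add {f g : ℝ → E} (hf : ExpGrowth f) (hg : ExpGrowth g) :
    ExpGrowth fun s => f s + g s := by
  obtain ⟨K, ω, hK, hω, hb⟩ := hf
  obtain ⟨K', ω', hK', hω', hb'⟩ := hg
  refine ⟨K + K', max ω ω', by positivity, le_max_of_le_left hω, fun s => ?_⟩
  have h1 : Real.exp (ω * |s|) ≤ Real.exp (max ω ω' * |s|) :=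
    Real.exp_le_exp.2 (mul_le_mul_of_nonneg_right (le_max_left _ _) (abs_nonneg s))
  have h2 : Real.exp (ω' * |s|) ≤ Real.exp (max ω ω' * |s|) :=
    Real.exp_le_exp.2 (mul_le_mul_of_nonneg_right (le_max_right _ _) (abs_nonneg s))
  calc ‖f s + g s‖ ≤ ‖f s‖ + ‖g s‖ := norm_add_le _ _
    _ ≤ K * Real.exp (ω * |s|) + K' * Real.exp (ω' * |s|) := add_le_add (hb s) (hb' s)
    _ ≤ K * Real.exp (max ω ω' * |s|) + K' * Real.exp (max ω ω' * |s|) := by gcongr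
    _ = _ := by ring

theorem neg {g : ℝ → E} (hg : ExpGrowth g) : ExpGrowth fun s => -g s :=
  hg.of_le fun s => by simp

theorem sub {f g : ℝ → E} (hf : ExpGrowth f) (hg : ExpGrowth g) :
    ExpGrowth fun s => f s - g s := by
  simpa only [sub_eq_add_neg] using hf.add hg.neg

theorem smul [NormedSpace ℝ E] {f : ℝ → ℝ} {g : ℝ → E} (hf : ExpGrowth f) (hg : ExpGrowth g) :
    ExpGrowth fun s => f s • g s := by
  obtain ⟨K, ω, hK, hω, hb⟩ := hf
  obtain ⟨K', ω', hK', hω', hb'⟩ := hg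
  refine ⟨K * K', ω + ω', by positivity, by positivity, fun s => ?_⟩
  rw [norm_smul, add_mul, Real.exp_add]
  calc ‖f s‖ * ‖g s‖ ≤ (K * Real.exp (ω * |s|)) * (K' * Real.exp (ω' * |s|)) :=
        mul_le_mul (hb s) (hb' s) (norm_nonneg _) (by positivity)
    _ = _ := by ring

theorem mul {f g : ℝ → ℝ} (hf : ExpGrowth f) (hg : ExpGrowth g) :
    ExpGrowth fun s => f s * g s :=
  hf.smul hg

theorem pow {f : ℝ → ℝ} (hf : ExpGrowth f) (n : ℕ) : ExpGrowth fun s => f s ^ n := by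
  induction n with
  | zero => simpa using const (1 : ℝ)
  | succ n ih => simpa only [pow_succ] using ih.mul hf

/-- A Gaussian factor beats exponential growth. -/
theorem exists_gaussian_bound {g : ℝ → E} (hg : ExpGrowth g) {b : ℝ} (hb : 0 < b) :
    ∃ C, 0 ≤ C ∧ ∀ s, ‖g s‖ ≤ C * Real.exp (b * s ^ 2) := by
  obtain ⟨K, ω, hK, hω, h⟩ := hg
  -- `ω²/(4b)` is the maximum of `ω|s| - b s²`, found by completing the square.
  refine ⟨K * Real.exp (ω ^ 2 / (4 * b)), by positivity, fun s => (h s).trans ?_⟩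
  rw [mul_assoc, ← Real.exp_add]
  refine mul_le_mul_of_nonneg_left (Real.exp_le_exp.2 ?_) hK
  have h1 : ω ^ 2 / (4 * b) + b * s ^ 2 - ω * |s| = (2 * b * |s| - ω) ^ 2 / (4 * b) := by
    rw [← sq_abs s]
    field_simp
    ring
  have h2 : 0 ≤ (2 * b * |s| - ω) ^ 2 / (4 * b) := by positivity
  linarith

theorem integrable_of_le {g : ℝ → E} (hg : ExpGrowth g) {F' : ℝ → F}
    (hm : AEStronglyMeasurable F' volume) {b : ℝ} (hb : 0 < b)
    (h : ∀ s, ‖F' s‖ ≤ Real.exp (-b * s ^ 2) * ‖g s‖) : Integrable F' := by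
  obtain ⟨C, -, hC⟩ := hg.exists_gaussian_bound (half_pos hb)
  refine ((integrable_exp_neg_mul_sq (half_pos hb)).const_mul C).mono' hm
    (Eventually.of_forall fun s => (h s).trans ?_)
  calc Real.exp (-b * s ^ 2) * ‖g s‖
      ≤ Real.exp (-b * s ^ 2) * (C * Real.exp (b / 2 * s ^ 2)) := by gcongr; exact hC s
    _ = C * (Real.exp (-b * s ^ 2) * Real.exp (b / 2 * s ^ 2)) := by ring
    _ = C * Real.exp (-(b / 2) * s ^ 2) := by
        rw [← Real.exp_add]
        congr 2
        ring

theorem integrable_gaussian_smul [NormedSpace ℝ E] {g : ℝ → E} (hg : ExpGrowth g)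
    (hc : Continuous g) {b : ℝ} (hb : 0 < b) :
    Integrable fun s => Real.exp (-b * s ^ 2) • g s := by
  refine hg.integrable_of_le (Continuous.aestronglyMeasurable (by fun_prop)) hb fun s => ?_
  rw [norm_smul, Real.norm_of_nonneg (Real.exp_nonneg _)]

theorem integrable_gaussian_one_smul [NormedSpace ℝ E] {g : ℝ → E} (hg : ExpGrowth g)
    (hc : Continuous g) : Integrable fun s => Real.exp (-s ^ 2) • g s := by
  simpa using hg.integrable_gaussian_smul hc one_pos

theorem integrable_gaussian_mul {g : ℝ → ℝ} (hg : ExpGrowth g) (hc : Continuous g) :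
    Integrable fun s => Real.exp (-s ^ 2) * g s :=
  hg.integrable_gaussian_one_smul hc

end ExpGrowth

/-! ### Hermite polynomials -/

theorem contDiff_gaussian : ContDiff ℝ ⊤ fun s : ℝ => Real.exp (-s ^ 2) := by fun_prop

theorem differentiable_iteratedDeriv_gaussian (n : ℕ) :
    Differentiable ℝ (iteratedDeriv n fun s : ℝ => Real.exp (-s ^ 2)) :=
  contDiff_gaussian.differentiable_iteratedDeriv n (WithTop.coe_lt_top _)

theorem hasDerivAt_iteratedDeriv_gaussian (n : ℕ) (t : ℝ) :
    HasDerivAt (iteratedDeriv n fun s : ℝ => Real.exp (-s ^ 2))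
      (iteratedDeriv (n + 1) (fun s : ℝ => Real.exp (-s ^ 2)) t) t := by
  rw [iteratedDeriv_succ]
  exact (differentiable_iteratedDeriv_gaussian n t).hasDerivAt

/-- This is `φ' = -2tφ` differentiated `n` times. At `n = 0` the truncated index `n - 1` is harmless
because its coefficient vanishes. -/
theorem iteratedDeriv_gaussian_succ (n : ℕ) (t : ℝ) :
    iteratedDeriv (n + 1) (fun s : ℝ => Real.exp (-s ^ 2)) t =
      -2 * t * iteratedDeriv n (fun s : ℝ => Real.exp (-s ^ 2)) t -
        2 * n * iteratedDeriv (n - 1) (fun s : ℝ => Real.exp (-s ^ 2)) t := by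
  induction n generalizing t with
  | zero =>
    have h : HasDerivAt (fun s : ℝ => Real.exp (-s ^ 2)) (Real.exp (-t ^ 2) * (-(2 * t))) t := by
      simpa using ((hasDerivAt_pow 2 t).neg).exp
    simp only [zero_add, iteratedDeriv_one, iteratedDeriv_zero, h.deriv]
    push_cast
    ring
  | succ n ih =>
    have h1 := hasDerivAt_iteratedDeriv_gaussian (n + 1) t
    have h2 : HasDerivAt (fun t => -2 * t * iteratedDeriv n (fun s : ℝ => Real.exp (-s ^ 2)) t -
        2 * n * iteratedDeriv (n - 1) (fun s : ℝ => Real.exp (-s ^ 2)) t)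
        (-2 * iteratedDeriv n (fun s : ℝ => Real.exp (-s ^ 2)) t +
          -2 * t * iteratedDeriv (n + 1) (fun s : ℝ => Real.exp (-s ^ 2)) t -
          2 * n * iteratedDeriv n (fun s : ℝ => Real.exp (-s ^ 2)) t) t := by
      refine HasDerivAt.sub ?_ ?_
      · exact (((hasDerivAt_id t).const_mul (-2)).mul
          (hasDerivAt_iteratedDeriv_gaussian n t)).congr_deriv (by simp)
      · rcases n with _ | n
        · simpa using hasDerivAt_const t (0 : ℝ)
        · exact (hasDerivAt_iteratedDeriv_gaussian n t).const_mul _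
    rw [funext ih] at h1
    rw [h1.unique h2, Nat.add_sub_cancel]
    push_cast
    ring

@[simp] theorem hermiteH_zero (t : ℝ) : hermiteH 0 t = 1 := by
  simp [hermiteH, ← Real.exp_add]

theorem hermiteH_succ (n : ℕ) (t : ℝ) :
    hermiteH (n + 1) t = 2 * t * hermiteH n t - 2 * n * hermiteH (n - 1) t := by
  rw [hermiteH, iteratedDeriv_gaussian_succ, hermiteH, hermiteH]
  rcases n with _ | n
  · simp
    ring
  · rw [Nat.add_sub_cancel]
    ring

theorem exp_mul_hermiteH (n : ℕ) (t : ℝ) :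
    Real.exp (-t ^ 2) * hermiteH n t =
      (-1) ^ n * iteratedDeriv n (fun s : ℝ => Real.exp (-s ^ 2)) t := by
  have : Real.exp (-t ^ 2) * Real.exp (t ^ 2) = 1 := by rw [← Real.exp_add]; simp
  rw [hermiteH]
  linear_combination (-1) ^ n * iteratedDeriv n (fun s : ℝ => Real.exp (-s ^ 2)) t * this

theorem hasDerivAt_exp_mul_hermiteH (n : ℕ) (t : ℝ) :
    HasDerivAt (fun t => Real.exp (-t ^ 2) * hermiteH n t)
      (-(Real.exp (-t ^ 2) * hermiteH (n + 1) t)) t := by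
  rw [funext (exp_mul_hermiteH n), exp_mul_hermiteH]
  exact ((hasDerivAt_iteratedDeriv_gaussian n t).const_mul ((-1) ^ n)).congr_deriv (by ring)

/-- The product rule for `e^{t²} · (e^{-t²} H_n)` gives `2t H_n - H_{n+1}`, which the recurrence
simplifies. -/
theorem hasDerivAt_hermiteH (n : ℕ) (t : ℝ) :
    HasDerivAt (hermiteH n) (2 * n * hermiteH (n - 1) t) t := by
  have h : hermiteH n = fun t => Real.exp (t ^ 2) * (Real.exp (-t ^ 2) * hermiteH n t) := by
    ext t
    rw [← mul_assoc, ← Real.exp_add]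
    simp
  have he : HasDerivAt (fun s : ℝ => Real.exp (s ^ 2)) (Real.exp (t ^ 2) * (2 * t)) t := by
    simpa using (hasDerivAt_pow 2 t).exp
  have key := he.mul (hasDerivAt_exp_mul_hermiteH n t)
  rw [h]
  have h1 : Real.exp (t ^ 2) * Real.exp (-t ^ 2) = 1 := by rw [← Real.exp_add]; simp
  refine key.congr_deriv ?_
  rw [hermiteH_succ]
  linear_combination (2 * n * hermiteH (n - 1) t) * h1

theorem continuous_hermiteH (n : ℕ) : Continuous (hermiteH n) :=
  continuous_iff_continuousAt.2 fun t => (hasDerivAt_hermiteH n t).continuousAt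

theorem expGrowth_hermiteH (n : ℕ) : ExpGrowth (hermiteH n) := by
  induction n using Nat.strong_induction_on with
  | _ n ih =>
    rcases n with _ | n
    · rw [show hermiteH 0 = fun _ => 1 from funext hermiteH_zero]
      exact ExpGrowth.const _
    · rw [funext (hermiteH_succ n)]
      exact (((ExpGrowth.const 2).mul ExpGrowth.id).mul (ih n (by omega))).sub
        ((ExpGrowth.const _).mul (ih (n - 1) (by omega)))

theorem integrable_exp_mul_hermiteH_smul {E : Type*} [NormedAddCommGroup E] [NormedSpace ℝ E]
    (n : ℕ) {g : ℝ → E} (hg : ExpGrowth g) (hc : Continuous g) :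
    Integrable fun s => (Real.exp (-s ^ 2) * hermiteH n s) • g s := by
  simpa only [mul_smul] using ((expGrowth_hermiteH n).smul hg).integrable_gaussian_one_smul
    ((continuous_hermiteH n).smul hc)

/-- Integration by parts against `e^{-s²} H_{n+1}`. -/
theorem integral_hermiteH_succ_smul {E : Type*} [NormedAddCommGroup E] [NormedSpace ℝ E]
    [CompleteSpace E]
    (n : ℕ) {g g' : ℝ → E} (hg : ExpGrowth g) (hg' : ExpGrowth g') (hc : Continuous g')
    (hd : ∀ s, HasDerivAt g (g' s) s) :
    ∫ s, (Real.exp (-s ^ 2) * hermiteH (n + 1) s) • g s =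
      ∫ s, (Real.exp (-s ^ 2) * hermiteH n s) • g' s := by
  have hgc : Continuous g := continuous_iff_continuousAt.2 fun t => (hd t).continuousAt
  have i1 := integrable_exp_mul_hermiteH_smul (n + 1) hg hgc
  have i2 := integrable_exp_mul_hermiteH_smul n hg' hc
  have h := integral_eq_zero_of_hasDerivAt_of_integrable
    (fun s => (hasDerivAt_exp_mul_hermiteH n s).smul (hd s))
    (by simp only [neg_smul, ← sub_eq_add_neg]; exact i2.sub i1)
    (integrable_exp_mul_hermiteH_smul n hg hgc)
  simp only [neg_smul, ← sub_eq_add_neg] at h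
  rw [integral_sub i2 i1, sub_eq_zero] at h
  exact h.symm

theorem integral_exp_neg_sq : ∫ s : ℝ, Real.exp (-s ^ 2) = √Real.pi := by
  simpa using integral_gaussian 1

theorem integral_hermiteH_succ (n : ℕ) :
    ∫ s, Real.exp (-s ^ 2) * hermiteH (n + 1) s = 0 := by
  simpa using integral_hermiteH_succ_smul n (ExpGrowth.const (1 : ℝ)) (ExpGrowth.const 0)
    continuous_const (fun s => hasDerivAt_const s 1)

/-- One integration by parts lowers both factors, so the squared norm is multiplied by `2(n+1)` at
each step. -/
theorem integral_hermiteH_sq (n : ℕ) :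
    ∫ s, Real.exp (-s ^ 2) * hermiteH n s ^ 2 = 2 ^ n * n ! * √Real.pi := by
  induction n with
  | zero => simp [integral_exp_neg_sq]
  | succ n ih =>
    have h := integral_hermiteH_succ_smul n (expGrowth_hermiteH (n + 1))
      ((ExpGrowth.const (2 * ((n + 1 : ℕ) : ℝ))).mul (expGrowth_hermiteH n))
      (continuous_const.mul (continuous_hermiteH n)) (hasDerivAt_hermiteH (n + 1))
    simp only [smul_eq_mul] at h
    calc ∫ s, Real.exp (-s ^ 2) * hermiteH (n + 1) s ^ 2
        = ∫ s, Real.exp (-s ^ 2) * hermiteH (n + 1) s * hermiteH (n + 1) s := by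
          simp only [sq (hermiteH _ _), mul_assoc]
      _ = ∫ s, (2 * ((n + 1 : ℕ) : ℝ)) * (Real.exp (-s ^ 2) * hermiteH n s ^ 2) := by
          rw [h]
          congr 1 with s
          ring
      _ = _ := by
          rw [integral_const_mul, ih, Nat.factorial_succ]
          push_cast
          ring

theorem integrable_hermiteH_sq (n : ℕ) :
    Integrable fun s => Real.exp (-s ^ 2) * hermiteH n s ^ 2 :=
  ((expGrowth_hermiteH n).pow 2).integrable_gaussian_mul ((continuous_hermiteH n).pow 2)

/-! ### Growth of the group; generator and Hermite integrals of orbits. -/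

namespace C0Group

variable {X : Type*} [NormedAddCommGroup X] [NormedSpace ℂ X]

theorem op_add_apply (T : C0Group X) (t s : ℝ) (x : X) : T.op (t + s) x = T.op t (T.op s x) := by
  rw [T.op_add]
  rfl

theorem op_nat_mul (T : C0Group X) (n : ℕ) (t : ℝ) : T.op (n * t) = T.op t ^ n := by
  induction n with
  | zero =>
    rw [Nat.cast_zero, zero_mul, T.op_zero, pow_zero]
    rfl
  | succ n ih =>
    rw [Nat.cast_succ, add_mul, one_mul, T.op_add, ih, pow_succ]
    rfl

/-- Uniform boundedness: each orbit is continuous, hence bounded on `[-1, 1]`. -/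
theorem exists_bound_of_abs_le_one [CompleteSpace X] (T : C0Group X) :
    ∃ M : ℝ, ∀ t : ℝ, |t| ≤ 1 → ‖T.op t‖ ≤ M := by
  obtain ⟨M, hM⟩ := banach_steinhaus (g := fun t : Set.Icc (-1 : ℝ) 1 => T.op t) fun x => by
    obtain ⟨C, hC⟩ := (isCompact_Icc (a := (-1 : ℝ)) (b := 1)).exists_bound_of_continuousOn
      (T.continuous_op x).continuousOn
    exact ⟨C, fun t => hC t t.2⟩
  exact ⟨M, fun t ht => hM ⟨t, abs_le.1 ht⟩⟩

/-- A `C₀`-group is of exponential growth in operator norm. -/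
theorem expGrowth_op [CompleteSpace X] (T : C0Group X) : ExpGrowth T.op := by
  obtain ⟨M₀, hM₀⟩ := T.exists_bound_of_abs_le_one
  set M := max M₀ 1
  have hM1 : 1 ≤ M := le_max_right _ _
  have hM0 : 0 < M := by positivity
  refine ⟨M ^ (2 : ℝ), Real.log M, by positivity, Real.log_nonneg hM1, fun t => ?_⟩
  rw [← Real.rpow_def_of_pos hM0, ← Real.rpow_add hM0]
  -- The extra `1` keeps `n` positive at `t = 0`; then `|t| ≤ n ≤ 2 + |t|`, whence the constant
  -- `M²`.
  set n : ℕ := ⌈|t|⌉₊ + 1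
  have hn : (0 : ℝ) < n := by positivity
  have hle : |t| ≤ n := (Nat.le_ceil _).trans (by simp [n])
  have hlt : (n : ℝ) ≤ 2 + |t| := by
    have := Nat.ceil_lt_add_one (abs_nonneg t)
    simp only [n]
    push_cast
    linarith
  have ht : T.op t = T.op (t / n) ^ n := by
    rw [← op_nat_mul]
    congr 1
    field_simp
  have hb : ‖T.op (t / n)‖ ≤ M := by
    refine (hM₀ _ ?_).trans (le_max_left _ _)
    rw [abs_div, Nat.abs_cast, div_le_one hn]
    exact hle
  calc ‖T.op t‖ ≤ ‖T.op (t / n)‖ ^ n := by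
        rw [ht]
        exact norm_pow_le' _ (Nat.succ_pos _)
    _ ≤ M ^ n := by gcongr
    _ = M ^ (n : ℝ) := (Real.rpow_natCast _ _).symm
    _ ≤ M ^ (2 + |t|) := Real.rpow_le_rpow_of_exponent_le hM1 hlt

theorem expGrowth_orbit [CompleteSpace X] (T : C0Group X) (x : X) :
    ExpGrowth fun t => T.op t x := by
  obtain ⟨K, ω, hK, hω, h⟩ := T.expGrowth_op
  refine ⟨K * ‖x‖, ω, by positivity, hω, fun t => ((T.op t).le_opNorm x).trans ?_⟩
  rw [mul_right_comm]
  gcongr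
  exact h t

theorem HasGen.hasDerivAt_orbit {T : C0Group X} {x y : X} (h : T.HasGen x y) (t : ℝ) :
    HasDerivAt (fun s => T.op s x) (T.op t y) t := by
  rw [hasDerivAt_iff_tendsto_slope_zero]
  refine (((T.op t).continuous.tendsto y).comp h).congr fun s => ?_
  rw [Function.comp_apply, op_add_apply, ← map_sub]
  exact ((T.op t).restrictScalars ℝ).map_smul s⁻¹ _

theorem norm_cexp_gaussian (z : ℂ) (t : ℝ) :
    ‖Complex.exp (-(t : ℂ) ^ 2 / (4 * z))‖ = Real.exp (-(((4 * z)⁻¹).re) * t ^ 2) := by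
  rw [Complex.norm_exp]
  congr 1
  rw [div_eq_mul_inv, ← Complex.ofReal_pow, ← Complex.ofReal_neg, Complex.re_ofReal_mul]
  ring

theorem integrable_gauss [CompleteSpace X] (T : C0Group X) {z : ℂ} (hz : 0 < z.re) (x : X) :
    Integrable (fun t : ℝ => Complex.exp (-(t : ℂ) ^ 2 / (4 * z)) • T.op t x) := by
  have hb : 0 < ((4 * z)⁻¹).re := by
    rw [Complex.inv_re]
    refine div_pos (by simpa using hz) (Complex.normSq_pos.2 fun h => ?_)
    have : z = 0 := by simpa using h
    simp [this] at hz
  have hc := T.continuous_op x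
  refine (T.expGrowth_orbit x).integrable_of_le (Continuous.aestronglyMeasurable (by fun_prop)) hb
    fun t => ?_
  rw [norm_smul, norm_cexp_gaussian]

/-- The integral `∫ e^{-t²} H_n(t) T(t)x dt`. -/
def hermiteIntegral (T : C0Group X) (n : ℕ) (x : X) : X :=
  ∫ t, (Real.exp (-t ^ 2) * hermiteH n t) • T.op t x

theorem integrable_hermiteIntegral [CompleteSpace X] (T : C0Group X) (n : ℕ) (x : X) :
    Integrable fun t => (Real.exp (-t ^ 2) * hermiteH n t) • T.op t x :=
  integrable_exp_mul_hermiteH_smul n (T.expGrowth_orbit x) (T.continuous_op x)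

/-- The group law moves `h` from the orbit to the smooth kernel, so differentiation in `h` needs no
regularity of `x`. -/
theorem op_hermiteIntegral [CompleteSpace X] (T : C0Group X) (n : ℕ) (x : X) (h : ℝ) :
    T.op h (T.hermiteIntegral n x) =
      ∫ t, (Real.exp (-(t - h) ^ 2) * hermiteH n (t - h)) • T.op t x := by
  rw [hermiteIntegral, ← (T.op h).integral_comp_comm (T.integrable_hermiteIntegral n x),
    ← integral_add_right_eq_self
      (fun t => (Real.exp (-(t - h) ^ 2) * hermiteH n (t - h)) • T.op t x) h]
  congr 1 with t
  rw [add_sub_cancel_right, add_comm t h, op_add_apply]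
  exact ((T.op h).restrictScalars ℝ).map_smul _ _

theorem hasGen_hermiteIntegral [CompleteSpace X] (T : C0Group X) (n : ℕ) (x : X) :
    T.HasGen (T.hermiteIntegral n x) (T.hermiteIntegral (n + 1) x) := by
  have hH := continuous_hermiteH
  have hT := T.continuous_op x
  obtain ⟨C, hC, hbound⟩ := (expGrowth_hermiteH (n + 1)).exists_gaussian_bound
    (show (0 : ℝ) < 1 / 2 by norm_num)
  have key : HasDerivAt
      (fun h => ∫ t, (Real.exp (-(t - h) ^ 2) * hermiteH n (t - h)) • T.op t x)
      (∫ t, (Real.exp (-(t - 0) ^ 2) * hermiteH (n + 1) (t - 0)) • T.op t x) 0 := by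
    refine (hasDerivAt_integral_of_dominated_loc_of_deriv_le
      (F := fun h t => (Real.exp (-(t - h) ^ 2) * hermiteH n (t - h)) • T.op t x)
      (F' := fun h t => (Real.exp (-(t - h) ^ 2) * hermiteH (n + 1) (t - h)) • T.op t x)
      -- Half of the Gaussian absorbs `H_{n+1}`; for `|h| ≤ 1` the other half satisfies `-(t-h)²/2 ≤
      -- 1 - t²/4`.
      (bound := fun t => C * Real.exp 1 * ‖Real.exp (-(1 / 4) * t ^ 2) • T.op t x‖)
      (Metric.ball_mem_nhds (0 : ℝ) one_pos) ?_ ?_ ?_ ?_ ?_ ?_).2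
    · exact Eventually.of_forall fun h => Continuous.aestronglyMeasurable (by fun_prop)
    · simpa using T.integrable_hermiteIntegral n x
    · exact Continuous.aestronglyMeasurable (by fun_prop)
    · refine Eventually.of_forall fun t h hh => ?_
      rw [norm_smul, norm_smul, ← mul_assoc, norm_mul, Real.norm_of_nonneg (Real.exp_nonneg _),
        Real.norm_of_nonneg (Real.exp_nonneg _)]
      refine mul_le_mul_of_nonneg_right ?_ (norm_nonneg _)
      have hh' : h ^ 2 ≤ 1 := by
        rw [sq_le_one_iff_abs_le_one, ← Real.norm_eq_abs]
        exact (mem_ball_zero_iff.1 hh).le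
      calc Real.exp (-(t - h) ^ 2) * ‖hermiteH (n + 1) (t - h)‖
          ≤ Real.exp (-(t - h) ^ 2) * (C * Real.exp (1 / 2 * (t - h) ^ 2)) := by
            gcongr
            exact hbound _
        _ = C * Real.exp (-(1 / 2) * (t - h) ^ 2) := by
            rw [mul_left_comm, ← Real.exp_add]
            congr 2
            ring
        _ ≤ C * Real.exp (1 + -(1 / 4) * t ^ 2) := by
            gcongr
            nlinarith [sq_nonneg (t - 2 * h)]
        _ = _ := by rw [Real.exp_add]; ring
    · exact (((T.expGrowth_orbit x).integrable_gaussian_smul hT (by norm_num)).norm).const_mul _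
    · refine Eventually.of_forall fun t h _ => ?_
      have h1 := (hasDerivAt_exp_mul_hermiteH n (t - h)).scomp h ((hasDerivAt_id h).const_sub t)
      exact (h1.smul_const (T.op t x)).congr_deriv (by simp)
  rw [hasDerivAt_iff_tendsto_slope_zero] at key
  refine (key.congr fun h => ?_).trans_eq (by simp [hermiteIntegral])
  rw [zero_add, ← op_hermiteIntegral, ← op_hermiteIntegral, T.op_zero]
  rfl

theorem HasGen.mem_domain {T : C0Group X} {x y : X} (h : T.HasGen x y) :
    x ∈ T.generator.domain :=
  ⟨y, h⟩

theorem HasGen.generator_eq {T : C0Group X} {x y : X} (h : T.HasGen x y)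
    (hx : x ∈ T.generator.domain) : T.generator ⟨x, hx⟩ = y :=
  (T.hasGen_generator ⟨x, hx⟩).unique h

/-- If `y (n + 1) = A (y n)` for all `n`, then `y 0` lies in the domain of every `A ^ n`, and
`A ^ n (y 0) = y n`. -/
theorem opPow_generator_of_hasGen {T : C0Group X} {y : ℕ → X}
    (h : ∀ n, T.HasGen (y n) (y (n + 1))) (n : ℕ) :
    ∃ hd : y 0 ∈ (opPow T.generator n).domain, opPow T.generator n ⟨y 0, hd⟩ = y n := by
  induction n with
  | zero => exact ⟨Submodule.mem_top, rfl⟩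
  | succ n ih =>
    obtain ⟨hd, he⟩ := ih
    have hmem : opPow T.generator n ⟨y 0, hd⟩ ∈ T.generator.domain := by
      rw [he]
      exact (h n).mem_domain
    refine ⟨(mem_opComp_domain _ _ _).2 ⟨hd, hmem⟩, ?_⟩
    change T.generator ⟨opPow T.generator n ⟨y 0, hd⟩, hmem⟩ = _
    exact HasGen.generator_eq (by rw [he]; exact h n) hmem

theorem gauss_one_div_four (T : C0Group X) (x : X) :
    T.gauss (1 / 4) x = (√Real.pi)⁻¹ • T.hermiteIntegral 0 x := by
  have h1 : (4 * (Real.pi : ℂ) * (1 / 4)) ^ (1 / 2 : ℂ) = ((√Real.pi : ℝ) : ℂ) := by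
    rw [Real.sqrt_eq_rpow, Complex.ofReal_cpow Real.pi_pos.le]
    push_cast
    congr 1
    ring
  rw [gauss, h1, hermiteIntegral, ← Complex.ofReal_inv, Complex.coe_smul]
  congr 2 with t
  rw [hermiteH_zero, mul_one, ← Complex.coe_smul]
  congr 1
  push_cast
  congr 1
  ring

theorem opPow_gauss [CompleteSpace X] (T : C0Group X) (n : ℕ) (x : X) :
    ∃ hd : T.gauss (1 / 4) x ∈ (opPow T.generator n).domain,
      opPow T.generator n ⟨T.gauss (1 / 4) x, hd⟩ = (√Real.pi)⁻¹ • T.hermiteIntegral n x := by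
  have := opPow_generator_of_hasGen (T := T) (y := fun n => (√Real.pi)⁻¹ • T.hermiteIntegral n x)
    (fun n => by
      have := (T.hasGen_hermiteIntegral n x).smul (((√Real.pi)⁻¹ : ℝ) : ℂ)
      rwa [Complex.coe_smul, Complex.coe_smul] at this) n
  simpa only [gauss_one_div_four] using this

theorem hermiteh_smul_op (T : C0Group X) (n : ℕ) (t : ℝ) (x : X) :
    hermiteh n t • T.op t x = (1 / (2 ^ n * (n ! : ℝ) * √Real.pi)) •
      (Real.exp (-t ^ 2) * hermiteH n t) • T.op t x := by
  rw [hermiteh, mul_assoc, mul_smul]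

theorem integrable_hermiteh_smul [CompleteSpace X] (T : C0Group X) (n : ℕ) (x : X) :
    Integrable fun t => hermiteh n t • T.op t x := by
  simp only [hermiteh_smul_op]
  exact (T.integrable_hermiteIntegral n x).smul _

theorem integral_hermiteh_smul (T : C0Group X) (n : ℕ) (x : X) :
    ∫ t, hermiteh n t • T.op t x =
      (1 / (2 ^ n * (n ! : ℝ))) • (√Real.pi)⁻¹ • T.hermiteIntegral n x := by
  simp only [hermiteh_smul_op]
  rw [integral_smul, smul_smul]
  congr 1
  rw [one_div, one_div, mul_inv]

end C0Group

/-! ### The `L¹` norm of the Hermite kernels and the norm estimate in (i). -/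

theorem integral_abs_exp_mul_hermiteH_le (n : ℕ) :
    ∫ t, |Real.exp (-t ^ 2) * hermiteH n t| ≤ √Real.pi * √(2 ^ n * (n ! : ℝ)) := by
  -- `σ` is the root mean square of `H_n` for the probability weight `e^{-t²}/√π`. With this choice
  -- `|H| ≤ H²/(2σ) + σ/2` integrates to the exact Cauchy–Schwarz bound.
  set σ := √(2 ^ n * (n ! : ℝ))
  have hσ : 0 < σ := by positivity
  have hσ2 : σ ^ 2 = 2 ^ n * (n ! : ℝ) := Real.sq_sqrt (by positivity)
  have hi : Integrable fun t => Real.exp (-t ^ 2) * hermiteH n t :=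
    (expGrowth_hermiteH n).integrable_gaussian_mul (continuous_hermiteH n)
  have hi1 : Integrable fun t : ℝ => Real.exp (-t ^ 2) * (1 : ℝ) :=
    (ExpGrowth.const 1).integrable_gaussian_mul continuous_const
  calc ∫ t, |Real.exp (-t ^ 2) * hermiteH n t|
      ≤ ∫ t, ((2 * σ)⁻¹ * (Real.exp (-t ^ 2) * hermiteH n t ^ 2) +
          σ / 2 * (Real.exp (-t ^ 2) * 1)) := by
        refine integral_mono hi.abs
          (((integrable_hermiteH_sq n).const_mul _).add (hi1.const_mul _)) fun t => ?_
        have h1 : |hermiteH n t| ≤ (2 * σ)⁻¹ * hermiteH n t ^ 2 + σ / 2 := by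
          have : (2 * σ)⁻¹ * hermiteH n t ^ 2 + σ / 2 - |hermiteH n t| =
              (|hermiteH n t| - σ) ^ 2 / (2 * σ) := by
            rw [← sq_abs (hermiteH n t)]
            field_simp
            ring
          have : 0 ≤ (|hermiteH n t| - σ) ^ 2 / (2 * σ) := by positivity
          linarith
        change |Real.exp (-t ^ 2) * hermiteH n t| ≤ _
        rw [abs_mul, abs_of_pos (Real.exp_pos _)]
        calc Real.exp (-t ^ 2) * |hermiteH n t|
            ≤ Real.exp (-t ^ 2) * ((2 * σ)⁻¹ * hermiteH n t ^ 2 + σ / 2) := by gcongr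
          _ = _ := by ring
    _ = √Real.pi * σ := by
        rw [integral_add ((integrable_hermiteH_sq n).const_mul _) (hi1.const_mul _),
          integral_const_mul, integral_const_mul, integral_hermiteH_sq, ← hσ2]
        simp only [mul_one, integral_exp_neg_sq]
        field_simp
        ring

namespace C0Group

variable {X : Type*} [NormedAddCommGroup X] [NormedSpace ℂ X]

theorem norm_hermiteIntegral_le (T : C0Group X) {M : ℝ} (hM : ∀ t, ‖T.op t‖ ≤ M)
    (n : ℕ) (x : X) :
    ‖(√Real.pi)⁻¹ • T.hermiteIntegral n x‖ ≤ M * √(2 ^ n * (n ! : ℝ)) * ‖x‖ := by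
  have hM0 : 0 ≤ M := (norm_nonneg _).trans (hM 0)
  have hi : Integrable fun t => Real.exp (-t ^ 2) * hermiteH n t :=
    (expGrowth_hermiteH n).integrable_gaussian_mul (continuous_hermiteH n)
  have h1 : ‖T.hermiteIntegral n x‖ ≤ ∫ t, |Real.exp (-t ^ 2) * hermiteH n t| * (M * ‖x‖) := by
    refine norm_integral_le_of_norm_le (hi.abs.mul_const _) (Eventually.of_forall fun t => ?_)
    rw [norm_smul, Real.norm_eq_abs]
    gcongr
    exact (T.op t).le_of_opNorm_le (hM t) x
  rw [integral_mul_const] at h1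
  have h2 := h1.trans
    (mul_le_mul_of_nonneg_right (integral_abs_exp_mul_hermiteH_le n) (by positivity))
  have hπ : 0 < √Real.pi := Real.sqrt_pos.2 Real.pi_pos
  rw [norm_smul, Real.norm_of_nonneg (by positivity), inv_mul_le_iff₀ hπ]
  linarith

end C0Group

/-! ### Normalized Hermite polynomials and their size -/

/-- The normalized Hermite polynomial `H_n / √(2^n n!)`. -/
def hermiteNormalized (n : ℕ) (s : ℝ) : ℝ :=
  hermiteH n s / √(2 ^ n * (n ! : ℝ))

theorem sqrt_two_pow_mul_factorial_succ (n : ℕ) :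
    √(2 ^ (n + 1) * ((n + 1)! : ℝ)) = √(2 * (n + 1)) * √(2 ^ n * (n ! : ℝ)) := by
  rw [← Real.sqrt_mul (by positivity), Nat.factorial_succ]
  congr 1
  push_cast
  ring

theorem hermiteH_eq_mul_normalized (n : ℕ) (s : ℝ) :
    hermiteH n s = √(2 ^ n * (n ! : ℝ)) * hermiteNormalized n s := by
  have : √(2 ^ n * (n ! : ℝ)) ≠ 0 := by positivity
  rw [hermiteNormalized]
  field_simp

theorem hermiteNormalized_sq (n : ℕ) (s : ℝ) :
    hermiteNormalized n s ^ 2 = hermiteH n s ^ 2 / (2 ^ n * (n ! : ℝ)) := by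
  rw [hermiteNormalized, div_pow, Real.sq_sqrt (by positivity)]

theorem continuous_hermiteNormalized (n : ℕ) : Continuous (hermiteNormalized n) :=
  (continuous_hermiteH n).div_const _

theorem expGrowth_hermiteNormalized (n : ℕ) : ExpGrowth (hermiteNormalized n) := by
  have := (ExpGrowth.const (√(2 ^ n * (n ! : ℝ)))⁻¹).mul (expGrowth_hermiteH n)
  exact this.of_le fun s => by rw [hermiteNormalized, div_eq_inv_mul]

theorem integral_hermiteNormalized_sq (n : ℕ) :
    ∫ s, Real.exp (-s ^ 2) * hermiteNormalized n s ^ 2 = √Real.pi := by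
  simp only [hermiteNormalized_sq, ← mul_div_assoc]
  rw [integral_div, integral_hermiteH_sq]
  field_simp

theorem integrable_hermiteNormalized_sq (n : ℕ) :
    Integrable fun s => Real.exp (-s ^ 2) * hermiteNormalized n s ^ 2 :=
  ((expGrowth_hermiteNormalized n).pow 2).integrable_gaussian_mul
    ((continuous_hermiteNormalized n).pow 2)

/-- At the origin the recurrence links only indices two apart and multiplies the normalized square
by `(n+1)/(n+2)`. The case `n = 1` starts the odd chain, which is zero. -/
theorem hermiteNormalized_zero_sq_mul_sqrt_le (n : ℕ) :
    hermiteNormalized n 0 ^ 2 * √(n + 1) ≤ 1 := by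
  have key : (hermiteNormalized n 0 ^ 2) ^ 2 * (n + 1) ≤ 1 := by
    induction n using Nat.twoStepInduction with
    | zero => simp [hermiteNormalized]
    | one => simp [hermiteNormalized, hermiteH_succ]
    | more n ih _ =>
      have h : hermiteNormalized (n + 2) 0 ^ 2 = (n + 1) / (n + 2) * hermiteNormalized n 0 ^ 2 := by
        rw [hermiteNormalized_sq, hermiteNormalized_sq, hermiteH_succ, Nat.factorial_succ,
          Nat.factorial_succ]
        push_cast
        field_simp
        ring
      rw [h, mul_pow]
      -- This amounts to `(n+1)(n+3) ≤ (n+2)²`.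
      have h3 : ((n + 1 : ℝ) / (n + 2)) ^ 2 * ((n + 2 : ℕ) + 1 : ℝ) ≤ n + 1 := by
        rw [div_pow, div_mul_eq_mul_div, div_le_iff₀ (by positivity)]
        push_cast
        nlinarith [(Nat.cast_nonneg n : (0 : ℝ) ≤ n)]
      calc ((n + 1 : ℝ) / (n + 2)) ^ 2 * (hermiteNormalized n 0 ^ 2) ^ 2 * ((n + 2 : ℕ) + 1 : ℝ)
          = (hermiteNormalized n 0 ^ 2) ^ 2 *
              (((n + 1 : ℝ) / (n + 2)) ^ 2 * ((n + 2 : ℕ) + 1 : ℝ)) := by ring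
        _ ≤ (hermiteNormalized n 0 ^ 2) ^ 2 * (n + 1) := by gcongr
        _ ≤ 1 := ih
  refine (sq_le_one_iff₀ (by positivity)).1 ?_
  rwa [mul_pow, Real.sq_sqrt (by positivity)]

/-- The energy of the Hermite function `u = e^{-s²/2} H_n`, a solution of
`u'' + (2n + 1 - s²) u = 0`. -/
def hermiteEnergy (n : ℕ) (s : ℝ) : ℝ :=
  Real.exp (-s ^ 2) * ((2 * n * hermiteH (n - 1) s - s * hermiteH n s) ^ 2 +
    (2 * n + 1 - s ^ 2) * hermiteH n s ^ 2)

/-- The energy is `u'² + (2n+1-s²)u²`. The equation for `u` cancels everything except the derivative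
of the coefficient, `-2s u²`. -/
theorem hasDerivAt_hermiteEnergy (n : ℕ) (s : ℝ) :
    HasDerivAt (hermiteEnergy n) (-2 * s * (Real.exp (-s ^ 2) * hermiteH n s ^ 2)) s := by
  have he : HasDerivAt (fun s : ℝ => Real.exp (-s ^ 2)) (Real.exp (-s ^ 2) * (-(2 * s))) s := by
    simpa using ((hasDerivAt_pow 2 s).neg).exp
  have h0 := hasDerivAt_hermiteH n s
  -- Hermite's equation `H_n'' = 2s H_n' - 2n H_n`, with `H_n'` written as `2n H_{n-1}`.
  have h1 : HasDerivAt (fun s => 2 * n * hermiteH (n - 1) s)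
      (2 * s * (2 * n * hermiteH (n - 1) s) - 2 * n * hermiteH n s) s := by
    rcases n with _ | n
    · simpa using hasDerivAt_const s (0 : ℝ)
    · refine ((hasDerivAt_hermiteH n s).const_mul (2 * ((n + 1 : ℕ) : ℝ))).congr_deriv ?_
      rw [hermiteH_succ n s, Nat.add_sub_cancel]
      ring
  have h2 := (h1.sub ((hasDerivAt_id s).mul h0)).pow 2
  have h3 := ((hasDerivAt_pow 2 s).const_sub (2 * n + 1 : ℝ)).mul (h0.pow 2)
  refine (he.mul (h2.add h3)).congr_deriv ?_
  simp
  ring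

/-- The derivative has the sign of `-s`, so the energy peaks at the origin. -/
theorem hermiteEnergy_le (n : ℕ) (s : ℝ) : hermiteEnergy n s ≤ hermiteEnergy n 0 := by
  have hd := hasDerivAt_hermiteEnergy n
  have hc : Continuous (hermiteEnergy n) :=
    continuous_iff_continuousAt.2 fun t => (hd t).continuousAt
  rcases le_total 0 s with hs | hs
  · refine antitoneOn_of_deriv_nonpos (convex_Ici 0) hc.continuousOn
      (fun t _ => (hd t).differentiableAt.differentiableWithinAt) (fun t ht => ?_)
      Set.self_mem_Ici hs hs
    rw [interior_Ici, Set.mem_Ioi] at ht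
    rw [(hd t).deriv]
    have : 0 ≤ t * (Real.exp (-t ^ 2) * hermiteH n t ^ 2) := by positivity
    linarith
  · refine monotoneOn_of_deriv_nonneg (convex_Iic 0) hc.continuousOn
      (fun t _ => (hd t).differentiableAt.differentiableWithinAt) (fun t ht => ?_)
      hs Set.self_mem_Iic hs
    rw [interior_Iic, Set.mem_Iio] at ht
    rw [(hd t).deriv]
    have : 0 ≤ -t * (Real.exp (-t ^ 2) * hermiteH n t ^ 2) := by
      have : 0 ≤ -t := by linarith
      positivity
    linarith

theorem hermiteEnergy_zero_le (n : ℕ) :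
    hermiteEnergy n 0 ≤ 4 * √(n + 1) * (2 ^ n * (n ! : ℝ)) := by
  have hE : hermiteEnergy n 0 =
      (2 * n * hermiteH (n - 1) 0) ^ 2 + (2 * n + 1) * hermiteH n 0 ^ 2 := by
    simp [hermiteEnergy]
  have hs : (√(n + 1 : ℝ)) ^ 2 = n + 1 := Real.sq_sqrt (by positivity)
  have h1 : hermiteH n 0 ^ 2 * √(n + 1) ≤ 2 ^ n * (n ! : ℝ) := by
    have := hermiteNormalized_zero_sq_mul_sqrt_le n
    rwa [hermiteNormalized_sq, div_mul_eq_mul_div, div_le_one (by positivity)] at this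
  have h2 : (2 * n * hermiteH (n - 1) 0) ^ 2 ≤ 2 * √(n + 1) * (2 ^ n * (n ! : ℝ)) := by
    rcases n with _ | n
    · simp
    · have := hermiteNormalized_zero_sq_mul_sqrt_le n
      rw [hermiteNormalized_sq, div_mul_eq_mul_div, div_le_one (by positivity)] at this
      have hs' : (√(n + 1 : ℝ)) ^ 2 = n + 1 := Real.sq_sqrt (by positivity)
      have hle : √(n + 1 : ℝ) ≤ √((n + 1 : ℕ) + 1 : ℝ) := Real.sqrt_le_sqrt (by push_cast; linarith)
      rw [Nat.add_sub_cancel, Nat.factorial_succ]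
      calc (2 * ((n + 1 : ℕ) : ℝ) * hermiteH n 0) ^ 2
          = 4 * (n + 1) * (√(n + 1 : ℝ)) * (hermiteH n 0 ^ 2 * √(n + 1 : ℝ)) := by
            push_cast
            linear_combination (-4 * (n + 1) * hermiteH n 0 ^ 2) * hs'
        _ ≤ 4 * (n + 1) * √((n + 1 : ℕ) + 1 : ℝ) * (2 ^ n * (n ! : ℝ)) := by gcongr
        _ = _ := by push_cast; ring
  have h3 : (2 * n + 1) * hermiteH n 0 ^ 2 ≤ 2 * √(n + 1) * (2 ^ n * (n ! : ℝ)) := by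
    calc (2 * n + 1) * hermiteH n 0 ^ 2 ≤ (2 * (√(n + 1 : ℝ)) ^ 2) * hermiteH n 0 ^ 2 := by
          gcongr
          rw [hs]
          linarith
      _ = 2 * √(n + 1) * (hermiteH n 0 ^ 2 * √(n + 1)) := by ring
      _ ≤ _ := by gcongr
  rw [hE]
  linarith

/-- The reciprocal of the pointwise decay rate of the normalized Hermite polynomials. -/
def hermiteRate (n : ℕ) : ℝ := √√((n : ℝ) + 1)

theorem hermiteRate_pos (n : ℕ) : 0 < hermiteRate n := by
  unfold hermiteRate
  positivity

theorem hermiteRate_sq (n : ℕ) : hermiteRate n ^ 2 = √((n : ℝ) + 1) :=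
  Real.sq_sqrt (by positivity)

theorem hermiteRate_le_succ (n : ℕ) : hermiteRate n ≤ hermiteRate (n + 1) :=
  Real.sqrt_le_sqrt (Real.sqrt_le_sqrt (by push_cast; linarith))

theorem tendsto_hermiteRate : Tendsto hermiteRate atTop atTop :=
  Real.tendsto_sqrt_atTop.comp (Real.tendsto_sqrt_atTop.comp
    (tendsto_natCast_atTop_atTop.atTop_add tendsto_const_nhds))

/-- For `s² ≤ n` the coefficient `2n+1-s²` is at least `n+1`, so the energy controls `(n+1)u²`. Its
value at `0` is only of order `√n · 2^n n!`, which leaves the decay `n^{-1/4}`. -/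
theorem abs_hermiteNormalized_le {n : ℕ} {s : ℝ} (hs : s ^ 2 ≤ n) :
    |hermiteNormalized n s| ≤ 2 * Real.exp (s ^ 2 / 2) / hermiteRate n := by
  have hr := hermiteRate_pos n
  have hd : (0 : ℝ) < 2 ^ n * (n ! : ℝ) := by positivity
  have hE := (hermiteEnergy_le n s).trans (hermiteEnergy_zero_le n)
  have h4 : hermiteRate n ^ 2 * hermiteRate n ^ 2 = n + 1 := by
    rw [hermiteRate_sq, Real.mul_self_sqrt (by positivity)]
  rw [← hermiteRate_sq] at hE
  have hx : Real.exp (-s ^ 2) * Real.exp (s ^ 2) = 1 := by rw [← Real.exp_add]; simp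
  have h1 : Real.exp (-s ^ 2) * ((n + 1) * hermiteH n s ^ 2) ≤ hermiteEnergy n s := by
    unfold hermiteEnergy
    gcongr
    have : 0 ≤ (2 * n * hermiteH (n - 1) s - s * hermiteH n s) ^ 2 := sq_nonneg _
    have : 0 ≤ (n - s ^ 2) * hermiteH n s ^ 2 := mul_nonneg (by linarith) (sq_nonneg _)
    linarith
  have h2 := h1.trans hE
  rw [hermiteH_eq_mul_normalized, mul_pow, Real.sq_sqrt hd.le, ← h4] at h2
  have h3 : (Real.exp (-s ^ 2) * hermiteNormalized n s ^ 2 * hermiteRate n ^ 2) *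
      (hermiteRate n ^ 2 * (2 ^ n * (n ! : ℝ))) ≤ 4 * (hermiteRate n ^ 2 * (2 ^ n * (n ! : ℝ))) := by
    linarith
  have h5 := le_of_mul_le_mul_right h3 (by positivity)
  rw [le_div_iff₀ hr]
  refine abs_le_of_sq_le_sq' ?_ (by positivity) |>.2
  rw [mul_pow, mul_pow, sq_abs, ← Real.exp_nat_mul]
  calc hermiteNormalized n s ^ 2 * hermiteRate n ^ 2
      = Real.exp (s ^ 2) * (Real.exp (-s ^ 2) * hermiteNormalized n s ^ 2 * hermiteRate n ^ 2) := by
        linear_combination (-hermiteNormalized n s ^ 2 * hermiteRate n ^ 2) * hx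
    _ ≤ Real.exp (s ^ 2) * 4 := by gcongr
    _ = _ := by
        rw [show ((2 : ℕ) : ℝ) * (s ^ 2 / 2) = s ^ 2 by push_cast; ring]
        ring

/-- A bound on the whole line. Where `s² ≥ n` one has `√(n+1) ≤ s² + 1`, so a polynomial weight buys
an additional inverse rate. -/
theorem hermiteRate_mul_abs_hermiteNormalized_le (n : ℕ) (s : ℝ) :
    hermiteRate n * |hermiteNormalized n s| ≤
      2 * Real.exp (s ^ 2 / 2) + (hermiteRate n)⁻¹ * (|hermiteNormalized n s| * (s ^ 2 + 1)) := by
  have hr := hermiteRate_pos n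
  rcases le_total (s ^ 2) n with hs | hs
  · have h1 := abs_hermiteNormalized_le hs
    rw [le_div_iff₀ hr] at h1
    have : 0 ≤ (hermiteRate n)⁻¹ * (|hermiteNormalized n s| * (s ^ 2 + 1)) := by positivity
    linarith
  · have h1 : 1 ≤ √((n : ℝ) + 1) := Real.one_le_sqrt.2 (by linarith [n.cast_nonneg (α := ℝ)])
    have h2 : hermiteRate n ^ 2 ≤ s ^ 2 + 1 := by
      rw [hermiteRate_sq]
      have := Real.mul_self_sqrt (show (0 : ℝ) ≤ n + 1 by positivity)
      nlinarith
    have h3 : hermiteRate n ≤ (hermiteRate n)⁻¹ * (s ^ 2 + 1) := by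
      rw [← div_eq_inv_mul, le_div_iff₀ hr, ← sq]
      exact h2
    calc hermiteRate n * |hermiteNormalized n s|
        ≤ ((hermiteRate n)⁻¹ * (s ^ 2 + 1)) * |hermiteNormalized n s| := by gcongr
      _ ≤ _ := by
        have := Real.exp_pos (s ^ 2 / 2)
        linarith

/-! ### Decay of Hermite coefficients -/

section Coeff

variable {E : Type*} [NormedAddCommGroup E] [NormedSpace ℝ E]

/-- The normalized Hermite coefficient `∫ e^{-s²} (H_n(s) / √(2^n n!)) g(s) ds`. -/
def hermiteCoeff (n : ℕ) (g : ℝ → E) : E :=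
  ∫ s, (Real.exp (-s ^ 2) * hermiteNormalized n s) • g s

theorem integrable_hermiteCoeff (n : ℕ) {g : ℝ → E} (hg : ExpGrowth g) (hc : Continuous g) :
    Integrable fun s => (Real.exp (-s ^ 2) * hermiteNormalized n s) • g s := by
  simpa only [mul_smul] using
    ((expGrowth_hermiteNormalized n).smul hg).integrable_gaussian_one_smul
      ((continuous_hermiteNormalized n).smul hc)

theorem integral_hermiteH_smul_eq (n : ℕ) (g : ℝ → E) :
    ∫ s, (Real.exp (-s ^ 2) * hermiteH n s) • g s = √(2 ^ n * (n ! : ℝ)) • hermiteCoeff n g := by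
  rw [hermiteCoeff, ← integral_smul]
  congr 1 with s
  rw [smul_smul, hermiteH_eq_mul_normalized, mul_left_comm]

/-- Pointwise `2ab ≤ a² + b²`; the normalization makes the bound uniform in `n`. -/
theorem integral_abs_hermiteNormalized_mul_le (n : ℕ) {k : ℝ → ℝ} (hg : ExpGrowth k)
    (hc : Continuous k) :
    ∫ s, Real.exp (-s ^ 2) * (|hermiteNormalized n s| * k s) ≤
      (√Real.pi + ∫ s, Real.exp (-s ^ 2) * k s ^ 2) / 2 := by
  have i2 : Integrable fun s => Real.exp (-s ^ 2) * k s ^ 2 :=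
    (hg.pow 2).integrable_gaussian_mul (hc.pow 2)
  have i1 : Integrable fun s => Real.exp (-s ^ 2) * (|hermiteNormalized n s| * k s) :=
    ((expGrowth_hermiteNormalized n).norm.mul hg).integrable_gaussian_mul
      ((continuous_hermiteNormalized n).norm.mul hc)
  rw [← integral_hermiteNormalized_sq n, ← integral_add (integrable_hermiteNormalized_sq n) i2,
    ← integral_div]
  refine integral_mono i1 (((integrable_hermiteNormalized_sq n).add i2).div_const 2) fun s => ?_
  have h := two_mul_le_add_sq |hermiteNormalized n s| (k s)
  rw [sq_abs] at h
  have := mul_le_mul_of_nonneg_left h (Real.exp_nonneg (-s ^ 2))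
  dsimp only
  linarith

theorem norm_hermiteCoeff_le (n : ℕ) {g : ℝ → E} (hg : ExpGrowth g) (hc : Continuous g) :
    ‖hermiteCoeff n g‖ ≤ (√Real.pi + ∫ s, Real.exp (-s ^ 2) * ‖g s‖ ^ 2) / 2 := by
  refine le_trans ?_ (integral_abs_hermiteNormalized_mul_le n hg.norm hc.norm)
  refine (norm_integral_le_integral_norm _).trans (le_of_eq ?_)
  congr 1 with s
  rw [norm_smul, norm_mul, Real.norm_of_nonneg (Real.exp_nonneg _), Real.norm_eq_abs, mul_assoc]

/-- `B` may depend on `g` but not on `n`, so the last term vanishes in the limit. The upper limit of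
the scaled coefficients is thus controlled by a weighted `L¹` norm, which permits approximation. -/
theorem hermiteRate_mul_norm_hermiteCoeff_le {g : ℝ → E} (hg : ExpGrowth g)
    (hc : Continuous g) : ∃ B, ∀ n, hermiteRate n * ‖hermiteCoeff n g‖ ≤
      2 * (∫ s, Real.exp (-(1 / 2) * s ^ 2) * ‖g s‖) + (hermiteRate n)⁻¹ * B := by
  have hsg : ExpGrowth fun s => (s ^ 2 + 1) * ‖g s‖ :=
    ((ExpGrowth.id.pow 2).add (ExpGrowth.const 1)).mul hg.norm
  have hsc : Continuous fun s => (s ^ 2 + 1) * ‖g s‖ := by fun_prop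
  refine ⟨_, fun n => le_trans ?_ (add_le_add_right (mul_le_mul_of_nonneg_left
    (integral_abs_hermiteNormalized_mul_le n hsg hsc) (inv_nonneg.2 (hermiteRate_pos n).le)) _)⟩
  have i1 : Integrable fun s => Real.exp (-(1 / 2) * s ^ 2) * ‖g s‖ :=
    hg.norm.integrable_gaussian_smul hc.norm (by norm_num)
  have i2 : Integrable fun s =>
      Real.exp (-s ^ 2) * (|hermiteNormalized n s| * ((s ^ 2 + 1) * ‖g s‖)) :=
    ((expGrowth_hermiteNormalized n).norm.mul hsg).integrable_gaussian_mul
      ((continuous_hermiteNormalized n).norm.mul hsc)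
  have i0 := (integrable_hermiteCoeff n hg hc).norm
  have h0 : hermiteRate n * ‖hermiteCoeff n g‖ ≤
      ∫ s, hermiteRate n * ‖(Real.exp (-s ^ 2) * hermiteNormalized n s) • g s‖ := by
    rw [integral_const_mul]
    exact mul_le_mul_of_nonneg_left (norm_integral_le_integral_norm _) (hermiteRate_pos n).le
  refine h0.trans ?_
  rw [← integral_const_mul, ← integral_const_mul, ← integral_add (i1.const_mul _) (i2.const_mul _)]
  refine integral_mono (i0.const_mul _) ((i1.const_mul _).add (i2.const_mul _)) fun s => ?_
  have h := mul_le_mul_of_nonneg_left (hermiteRate_mul_abs_hermiteNormalized_le n s)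
    (show 0 ≤ Real.exp (-s ^ 2) * ‖g s‖ by positivity)
  have he : Real.exp (-s ^ 2) * Real.exp (s ^ 2 / 2) = Real.exp (-(1 / 2) * s ^ 2) := by
    rw [← Real.exp_add]
    congr 1
    ring
  dsimp only
  rw [norm_smul, norm_mul, Real.norm_of_nonneg (Real.exp_nonneg _), Real.norm_eq_abs, ← he]
  linarith

theorem hermiteCoeff_succ [CompleteSpace E] (n : ℕ) {g g' : ℝ → E} (hg : ExpGrowth g)
    (hg' : ExpGrowth g') (hc : Continuous g') (hd : ∀ s, HasDerivAt g (g' s) s) :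
    √(2 * ((n : ℝ) + 1)) • hermiteCoeff (n + 1) g = hermiteCoeff n g' := by
  have h := integral_hermiteH_succ_smul n hg hg' hc hd
  rw [integral_hermiteH_smul_eq, integral_hermiteH_smul_eq, sqrt_two_pow_mul_factorial_succ,
    mul_comm, mul_smul] at h
  exact smul_right_injective E (r := √(2 ^ n * (n ! : ℝ))) (by positivity) h

/-- Integration by parts gains `n^{-1/2}`, which beats the factor `n^{1/4}`. -/
theorem tendsto_hermiteRate_mul_norm_hermiteCoeff_of_hasDerivAt [CompleteSpace E] {g g' : ℝ → E}
    (hg : ExpGrowth g) (hg' : ExpGrowth g') (hc : Continuous g')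
    (hd : ∀ s, HasDerivAt g (g' s) s) :
    Tendsto (fun n => hermiteRate n * ‖hermiteCoeff n g‖) atTop (𝓝 0) := by
  rw [← tendsto_add_atTop_iff_nat 1]
  set B := (√Real.pi + ∫ s, Real.exp (-s ^ 2) * ‖g' s‖ ^ 2) / 2
  have hlim : Tendsto (fun n => (hermiteRate (n + 1))⁻¹ * B) atTop (𝓝 0) := by
    simpa using ((tendsto_inv_atTop_zero.comp tendsto_hermiteRate).comp
      (tendsto_add_atTop_nat 1)).mul_const B
  refine squeeze_zero (fun n => mul_nonneg (hermiteRate_pos _).le (norm_nonneg _)) (fun n => ?_)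
    hlim
  have h1 : √(2 * ((n : ℝ) + 1)) * ‖hermiteCoeff (n + 1) g‖ ≤ B := by
    rw [← Real.norm_of_nonneg (Real.sqrt_nonneg (2 * ((n : ℝ) + 1))), ← norm_smul,
      hermiteCoeff_succ n hg hg' hc hd]
    exact norm_hermiteCoeff_le n hg' hc
  have h2 : hermiteRate (n + 1) ^ 2 ≤ √(2 * ((n : ℝ) + 1)) := by
    rw [hermiteRate_sq]
    exact Real.sqrt_le_sqrt (by push_cast; linarith [n.cast_nonneg (α := ℝ)])
  rw [← div_eq_inv_mul, le_div_iff₀ (hermiteRate_pos _)]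
  calc hermiteRate (n + 1) * ‖hermiteCoeff (n + 1) g‖ * hermiteRate (n + 1)
      = hermiteRate (n + 1) ^ 2 * ‖hermiteCoeff (n + 1) g‖ := by ring
    _ ≤ √(2 * ((n : ℝ) + 1)) * ‖hermiteCoeff (n + 1) g‖ := by gcongr
    _ ≤ B := h1

/-- A continuous function of exponential growth is approximated in `L¹(e^{-s²/2} ds)` by `C¹`
functions of exponential growth with derivatives of exponential growth: its forward averages. -/
theorem ExpGrowth.exists_hasDerivAt_approx [CompleteSpace E] {g : ℝ → E} (hg : ExpGrowth g)
    (hc : Continuous g) {ε : ℝ} (hε : 0 < ε) :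
    ∃ f f' : ℝ → E, ExpGrowth f ∧ ExpGrowth f' ∧ Continuous f' ∧ (∀ s, HasDerivAt f (f' s) s) ∧
      ∫ s, Real.exp (-(1 / 2) * s ^ 2) * ‖g s - f s‖ < ε := by
  obtain ⟨K, ω, hK, hω, hb⟩ := hg
  set G : ℝ → E := fun s => ∫ u in (0 : ℝ)..s, g u
  have hG : ∀ s, HasDerivAt G (g s) s := fun s =>
    intervalIntegral.integral_hasDerivAt_right (hc.intervalIntegrable _ _)
      (hc.stronglyMeasurableAtFilter _ _) hc.continuousAt
  -- The double inverse keeps the form of the slope of `G` with step `(n+1)⁻¹`, so pointwise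
  -- convergence to `g` is the derivative of the primitive.
  set f : ℕ → ℝ → E := fun n s => (((n : ℝ) + 1)⁻¹)⁻¹ • (G (s + ((n : ℝ) + 1)⁻¹) - G s)
  have hδ : ∀ n : ℕ, ((n : ℝ) + 1)⁻¹ ≤ 1 := fun n =>
    inv_le_one_of_one_le₀ (by linarith [n.cast_nonneg (α := ℝ)])
  have hshift : ∀ s u δ : ℝ, 0 ≤ δ → δ ≤ 1 → u ∈ Set.uIoc s (s + δ) →
      ‖g u‖ ≤ K * Real.exp ω * Real.exp (ω * |s|) := by
    intro s u δ h0 h1 hu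
    rw [Set.uIoc_of_le (by linarith)] at hu
    refine (hb u).trans ?_
    rw [mul_assoc, ← Real.exp_add]
    have : |u| ≤ 1 + |s| := by
      have : |u - s| ≤ 1 := abs_le.2 ⟨by linarith [hu.1], by linarith [hu.2]⟩
      have := abs_sub_abs_le_abs_sub u s
      linarith
    gcongr
    nlinarith
  have hfb : ∀ n s, ‖f n s‖ ≤ K * Real.exp ω * Real.exp (ω * |s|) := by
    intro n s
    have hp : 0 < ((n : ℝ) + 1)⁻¹ := by positivity
    have h1 : G (s + ((n : ℝ) + 1)⁻¹) - G s = ∫ u in s..(s + ((n : ℝ) + 1)⁻¹), g u :=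
      intervalIntegral.integral_interval_sub_left (hc.intervalIntegrable _ _)
        (hc.intervalIntegrable _ _)
    have h2 := intervalIntegral.norm_integral_le_of_norm_le_const
      (fun u hu => hshift s u _ hp.le (hδ n) hu)
    rw [add_sub_cancel_left, abs_of_pos hp] at h2
    simp only [f]
    rw [norm_smul, h1, Real.norm_of_nonneg (by positivity), inv_mul_le_iff₀ hp, mul_comm]
    exact h2
  have hfd : ∀ n s, HasDerivAt (f n)
      ((((n : ℝ) + 1)⁻¹)⁻¹ • (g (s + ((n : ℝ) + 1)⁻¹) - g s)) s := fun n s =>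
    (((hG _).comp_add_const s _).sub (hG s)).const_smul _
  have hfg : ∀ n, ExpGrowth (f n) := fun n => ⟨_, ω, by positivity, hω, hfb n⟩
  have hfc : ∀ n, Continuous (f n) := fun n =>
    continuous_iff_continuousAt.2 fun s => (hfd n s).continuousAt
  have hlim : Tendsto (fun n => ∫ s, Real.exp (-(1 / 2) * s ^ 2) * ‖g s - f n s‖) atTop
      (𝓝 (∫ _ : ℝ, 0)) := by
    refine tendsto_integral_of_dominated_convergence
      (fun s => Real.exp (-(1 / 2) * s ^ 2) *
        (K * Real.exp (ω * |s|) + K * Real.exp ω * Real.exp (ω * |s|)))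
      (fun n => ?_) ?_ (fun n => Eventually.of_forall fun s => ?_)
      (Eventually.of_forall fun s => ?_)
    · have := hfc n
      exact Continuous.aestronglyMeasurable (by fun_prop)
    · have he : ExpGrowth fun s : ℝ => Real.exp (ω * |s|) :=
        ⟨1, ω, zero_le_one, hω, fun s => by rw [Real.norm_of_nonneg (Real.exp_nonneg _), one_mul]⟩
      exact (((ExpGrowth.const K).mul he).add
        ((ExpGrowth.const (K * Real.exp ω)).mul he)).integrable_gaussian_smul
          (by fun_prop) (by norm_num)
    · rw [Real.norm_of_nonneg (by positivity)]
      gcongr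
      exact (norm_sub_le _ _).trans (add_le_add (hb s) (hfb n s))
    · have h1 : Tendsto (fun n : ℕ => ((n : ℝ) + 1)⁻¹) atTop (𝓝[≠] 0) := by
        refine tendsto_nhdsWithin_iff.2 ⟨?_, Eventually.of_forall fun n => ?_⟩
        · simpa [one_div] using tendsto_one_div_add_atTop_nhds_zero_nat (𝕜 := ℝ)
        · exact (show (0 : ℝ) < ((n : ℝ) + 1)⁻¹ by positivity).ne'
      have h2 : Tendsto (fun n => f n s) atTop (𝓝 (g s)) :=
        (hasDerivAt_iff_tendsto_slope_zero.1 (hG s)).comp h1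
      refine (((tendsto_const_nhds (x := g s)).sub h2).norm.const_mul
        (Real.exp (-(1 / 2) * s ^ 2))).trans_eq ?_
      rw [sub_self, norm_zero, mul_zero]
  rw [integral_zero] at hlim
  obtain ⟨n, hn⟩ := (hlim.eventually (gt_mem_nhds hε)).exists
  refine ⟨f n, _, hfg n, ?_, ?_, hfd n, hn⟩
  · refine (ExpGrowth.const _).smul (ExpGrowth.sub ?_ ⟨K, ω, hK, hω, hb⟩)
    exact ⟨_, ω, by positivity, hω, fun s => hshift s _ _ (by positivity) (hδ n)
      (by
        have hp : 0 < ((n : ℝ) + 1)⁻¹ := by positivity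
        rw [Set.uIoc_of_le (by linarith)]
        exact ⟨by linarith, le_rfl⟩)⟩
  · fun_prop

/-- The Hermite coefficients of a continuous function of exponential growth are `o(n^{-1/4})`. -/
theorem tendsto_hermiteRate_mul_norm_hermiteCoeff [CompleteSpace E] {g : ℝ → E}
    (hg : ExpGrowth g) (hc : Continuous g) :
    Tendsto (fun n => hermiteRate n * ‖hermiteCoeff n g‖) atTop (𝓝 0) := by
  rw [Metric.tendsto_atTop']
  intro ε hε
  obtain ⟨f, f', hf, hf', hfc', hfd, hlt⟩ :=
    -- The factor `2` in the bound by `B` turns `ε/4` into `ε/2`; the vanishing terms take the other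
    -- half.
    hg.exists_hasDerivAt_approx hc (show 0 < ε / 4 by positivity)
  have hfc : Continuous f := continuous_iff_continuousAt.2 fun s => (hfd s).continuousAt
  obtain ⟨B, hB⟩ := hermiteRate_mul_norm_hermiteCoeff_le (hg.sub hf) (hc.sub hfc)
  have hlim : Tendsto (fun n => (hermiteRate n)⁻¹ * B + hermiteRate n * ‖hermiteCoeff n f‖)
      atTop (𝓝 0) := by
    simpa using ((tendsto_inv_atTop_zero.comp tendsto_hermiteRate).mul_const B).add
      (tendsto_hermiteRate_mul_norm_hermiteCoeff_of_hasDerivAt hf hf' hfc' hfd)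
  obtain ⟨N, hN⟩ := eventually_atTop.1 (hlim.eventually (gt_mem_nhds (half_pos hε)))
  refine ⟨N, fun n hn => ?_⟩
  have h1 := hN n hn.le
  have hsplit : hermiteCoeff n g = hermiteCoeff n (fun s => g s - f s) + hermiteCoeff n f := by
    simp only [hermiteCoeff, smul_sub]
    rw [integral_sub (integrable_hermiteCoeff n hg hc) (integrable_hermiteCoeff n hf hfc),
      sub_add_cancel]
  have hr := hermiteRate_pos n
  rw [dist_zero_right, Real.norm_of_nonneg (by positivity)]
  have h2 : hermiteRate n * ‖hermiteCoeff n g‖ ≤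
      hermiteRate n * ‖hermiteCoeff n (fun s => g s - f s)‖ +
        hermiteRate n * ‖hermiteCoeff n f‖ := by
    rw [← mul_add, hsplit]
    exact mul_le_mul_of_nonneg_left (norm_add_le _ _) hr.le
  linarith [hB n]

end Coeff

/-! ### Pointwise convergence of Hermite expansions -/

theorem hermite_christoffel_darboux (m : ℕ) (t s : ℝ) :
    (∑ n ∈ Finset.range (m + 1), 1 / (2 ^ n * (n ! : ℝ)) * hermiteH n t * hermiteH n s) * (t - s) =
      (hermiteH (m + 1) t * hermiteH m s - hermiteH m t * hermiteH (m + 1) s) /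
        (2 ^ (m + 1) * (m ! : ℝ)) := by
  induction m with
  | zero =>
    simp [hermiteH_succ]
    ring
  | succ m ih =>
    rw [Finset.sum_range_succ, add_mul, ih, hermiteH_succ (m + 1) t, hermiteH_succ (m + 1) s,
      Nat.add_sub_cancel, Nat.factorial_succ]
    push_cast
    field_simp
    ring

theorem hermite_christoffel_darboux_normalized (m : ℕ) (t s : ℝ) :
    (∑ n ∈ Finset.range (m + 1), 1 / (2 ^ n * (n ! : ℝ)) * hermiteH n t * hermiteH n s) * (t - s) =
      √(2 * ((m : ℝ) + 1)) / 2 * (hermiteNormalized (m + 1) t * hermiteNormalized m s -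
        hermiteNormalized m t * hermiteNormalized (m + 1) s) := by
  have hs : √(2 ^ m * (m ! : ℝ)) ^ 2 = 2 ^ m * (m ! : ℝ) := Real.sq_sqrt (by positivity)
  rw [hermite_christoffel_darboux, hermiteH_eq_mul_normalized, hermiteH_eq_mul_normalized m,
    hermiteH_eq_mul_normalized m, hermiteH_eq_mul_normalized (m + 1),
    sqrt_two_pow_mul_factorial_succ, div_eq_iff (by positivity), pow_succ]
  linear_combination (√(2 * ((m : ℝ) + 1)) * (hermiteNormalized (m + 1) t * hermiteNormalized m s -
    hermiteNormalized m t * hermiteNormalized (m + 1) s)) * hs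

section

variable {E : Type*} [NormedAddCommGroup E] [NormedSpace ℝ E]

/-- Near `t` compactness suffices; where `|s - t| ≥ 1` the quotient is at most `‖f s‖ + ‖f t‖`. -/
theorem expGrowth_dslope {f : ℝ → E} {t : ℝ} (hf : ExpGrowth f)
    (hc : Continuous (dslope f t)) : ExpGrowth (dslope f t) := by
  obtain ⟨C, hC⟩ := (isCompact_Icc (a := t - 1) (b := t + 1)).exists_bound_of_continuousOn
    hc.continuousOn
  refine ((ExpGrowth.const C).norm.add (hf.norm.add (ExpGrowth.const (f t)).norm)).of_le
    fun s => ?_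
  rw [Real.norm_of_nonneg (by positivity)]
  by_cases hs : s ∈ Set.Icc (t - 1) (t + 1)
  · have h1 := (hC s hs).trans (le_abs_self C)
    rw [← Real.norm_eq_abs] at h1
    have : 0 ≤ ‖f s‖ + ‖f t‖ := by positivity
    linarith
  · have h1 : 1 ≤ |s - t| := by
      by_contra! h
      rw [abs_lt] at h
      exact hs ⟨by linarith, by linarith⟩
    have h2 : ‖dslope f t s‖ ≤ |s - t| * ‖dslope f t s‖ := le_mul_of_one_le_left (norm_nonneg _) h1
    rw [← Real.norm_eq_abs, ← norm_smul, sub_smul_dslope] at h2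
    have := norm_sub_le (f s) (f t)
    have := norm_nonneg C
    linarith

theorem sum_hermite_sub_eq [CompleteSpace E] {f : ℝ → E} {t : ℝ} (hf : ExpGrowth f)
    (hfc : Continuous f) (hg : ExpGrowth (dslope f t)) (hgc : Continuous (dslope f t)) (m : ℕ) :
    ∑ n ∈ Finset.range (m + 1), (1 / (2 ^ n * (n ! : ℝ)) * hermiteH n t) •
        (∫ s, (Real.exp (-s ^ 2) * hermiteH n s) • f s) - √Real.pi • f t =
      (-(√(2 * ((m : ℝ) + 1)) / 2)) • (hermiteNormalized (m + 1) t • hermiteCoeff m (dslope f t) -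
        hermiteNormalized m t • hermiteCoeff (m + 1) (dslope f t)) := by
  -- The constant `f t` is its own expansion: only `n = 0` survives. Subtracting it leaves `f s - f
  -- t = (s - t) • dslope f t s`, whose factor `s - t` Christoffel–Darboux consumes.
  have hconst : √Real.pi • f t = ∑ n ∈ Finset.range (m + 1),
      (1 / (2 ^ n * (n ! : ℝ)) * hermiteH n t) •
        ∫ s, (Real.exp (-s ^ 2) * hermiteH n s) • f t := by
    rw [Finset.sum_range_succ', Finset.sum_eq_zero fun n _ => by
      rw [integral_smul_const, integral_hermiteH_succ, zero_smul, smul_zero]]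
    rw [integral_smul_const]
    simp [integral_exp_neg_sq]
  have hi : ∀ n, Integrable fun s => (Real.exp (-s ^ 2) * hermiteH n s) • (f s - f t) := fun n =>
    integrable_exp_mul_hermiteH_smul n (hf.sub (ExpGrowth.const _)) (hfc.sub continuous_const)
  rw [hconst, ← Finset.sum_sub_distrib]
  simp only [← smul_sub]
  have h1 : ∀ n, (∫ s, (Real.exp (-s ^ 2) * hermiteH n s) • f s) -
      ∫ s, (Real.exp (-s ^ 2) * hermiteH n s) • f t =
      ∫ s, (Real.exp (-s ^ 2) * hermiteH n s) • (f s - f t) := fun n => by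
    rw [← integral_sub (integrable_exp_mul_hermiteH_smul n hf hfc)
      (integrable_exp_mul_hermiteH_smul n (ExpGrowth.const _) continuous_const)]
    simp only [smul_sub]
  simp only [h1, ← integral_smul]
  have hi' : ∀ n, Integrable fun s => (1 / (2 ^ n * (n ! : ℝ)) * hermiteH n t) •
      (Real.exp (-s ^ 2) * hermiteH n s) • (f s - f t) := fun n => (hi n).smul _
  have hi1 : Integrable fun s => hermiteNormalized (m + 1) t •
      (Real.exp (-s ^ 2) * hermiteNormalized m s) • dslope f t s :=
    (integrable_hermiteCoeff m hg hgc).smul _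
  have hi2 : Integrable fun s => hermiteNormalized m t •
      (Real.exp (-s ^ 2) * hermiteNormalized (m + 1) s) • dslope f t s :=
    (integrable_hermiteCoeff (m + 1) hg hgc).smul _
  rw [← integral_finsetSum _ fun n _ => hi' n]
  simp only [hermiteCoeff, ← integral_smul]
  rw [← integral_sub hi1 hi2, ← integral_smul]
  congr 1 with s
  rw [← sub_smul_dslope]
  simp only [smul_smul, ← sub_smul, ← Finset.sum_smul]
  congr 1
  have hcd := hermite_christoffel_darboux_normalized m t s
  have hsum : ∑ n ∈ Finset.range (m + 1), 1 / (2 ^ n * (n ! : ℝ)) * hermiteH n t *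
      (Real.exp (-s ^ 2) * hermiteH n s * (s - t)) = -(Real.exp (-s ^ 2) *
      ((∑ n ∈ Finset.range (m + 1), 1 / (2 ^ n * (n ! : ℝ)) * hermiteH n t * hermiteH n s) *
        (t - s))) := by
    rw [Finset.sum_mul, Finset.mul_sum, ← Finset.sum_neg_distrib]
    exact Finset.sum_congr rfl fun n _ => by ring
  rw [hsum, hcd]
  ring

/-- The Hermite expansion of a continuous function of exponential growth converges at every point
of differentiability. -/
theorem tendsto_sum_hermite [CompleteSpace E] {f : ℝ → E} {t : ℝ} (hf : ExpGrowth f)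
    (hfc : Continuous f) (hd : DifferentiableAt ℝ f t) :
    Tendsto (fun m : ℕ => ∑ n ∈ Finset.range (m + 1), (1 / (2 ^ n * (n ! : ℝ)) * hermiteH n t) •
      (√Real.pi)⁻¹ • ∫ s, (Real.exp (-s ^ 2) * hermiteH n s) • f s) atTop (𝓝 (f t)) := by
  have hgc : Continuous (dslope f t) := continuous_iff_continuousAt.2 fun s => by
    rcases eq_or_ne s t with rfl | hs
    · exact continuousAt_dslope_same.2 hd
    · exact (continuousAt_dslope_of_ne hs).2 hfc.continuousAt
  have hg := expGrowth_dslope hf hgc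
  have hπ : √Real.pi ≠ 0 := (Real.sqrt_pos.2 Real.pi_pos).ne'
  have hcoeff := tendsto_hermiteRate_mul_norm_hermiteCoeff hg hgc
  have hlim : Tendsto (fun m => hermiteRate m * ‖hermiteCoeff m (dslope f t)‖ +
      hermiteRate (m + 1) * ‖hermiteCoeff (m + 1) (dslope f t)‖) atTop (𝓝 0) := by
    simpa using hcoeff.add (hcoeff.comp (tendsto_add_atTop_nat 1))
  have hdiff : Tendsto (fun m : ℕ => ∑ n ∈ Finset.range (m + 1),
      (1 / (2 ^ n * (n ! : ℝ)) * hermiteH n t) •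
        (∫ s, (Real.exp (-s ^ 2) * hermiteH n s) • f s) - √Real.pi • f t) atTop (𝓝 0) := by
    set C := 2 * Real.exp (t ^ 2 / 2)
    refine squeeze_zero_norm' ?_ (by simpa using hlim.const_mul C)
    -- From here on `t² ≤ m`, the range in which the energy bound applies.
    filter_upwards [eventually_ge_atTop ⌈t ^ 2⌉₊] with m hm
    have hm' : t ^ 2 ≤ m := (Nat.le_ceil _).trans (by exact_mod_cast hm)
    have hr := hermiteRate_pos m
    have hr' := hermiteRate_pos (m + 1)
    have hrr := hermiteRate_le_succ m
    have hQ := abs_hermiteNormalized_le hm'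
    have hQ' : |hermiteNormalized (m + 1) t| ≤ C / hermiteRate (m + 1) :=
      abs_hermiteNormalized_le (by push_cast; linarith)
    have hsq : √(2 * ((m : ℝ) + 1)) / 2 ≤ hermiteRate m ^ 2 := by
      rw [hermiteRate_sq, Real.sqrt_mul zero_le_two]
      have : √(2 : ℝ) ≤ 2 := Real.sqrt_le_iff.2 ⟨by norm_num, by norm_num⟩
      nlinarith [Real.sqrt_nonneg ((m : ℝ) + 1)]
    rw [sum_hermite_sub_eq hf hfc hg hgc, norm_smul, norm_neg, Real.norm_of_nonneg (by positivity)]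
    set a := ‖hermiteCoeff m (dslope f t)‖
    set b := ‖hermiteCoeff (m + 1) (dslope f t)‖
    have hC : 0 < C := by positivity
    have ha : 0 ≤ a := norm_nonneg _
    have hb : 0 ≤ b := norm_nonneg _
    calc √(2 * ((m : ℝ) + 1)) / 2 * ‖hermiteNormalized (m + 1) t • hermiteCoeff m (dslope f t) -
          hermiteNormalized m t • hermiteCoeff (m + 1) (dslope f t)‖
        ≤ hermiteRate m ^ 2 * (C / hermiteRate (m + 1) * a + C / hermiteRate m * b) := by
          gcongr
          refine (norm_sub_le _ _).trans ?_
          rw [norm_smul, norm_smul, Real.norm_eq_abs, Real.norm_eq_abs]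
          gcongr
      _ ≤ hermiteRate m ^ 2 * (C / hermiteRate m * a + C / hermiteRate m * b) := by gcongr
      _ = C * (hermiteRate m * a + hermiteRate m * b) := by field_simp
      _ ≤ C * (hermiteRate m * a + hermiteRate (m + 1) * b) := by gcongr
  have h := (hdiff.add_const (√Real.pi • f t)).const_smul (√Real.pi)⁻¹
  simp only [sub_add_cancel, zero_add, smul_smul, inv_mul_cancel₀ hπ, one_smul] at h
  refine h.congr fun m => ?_
  rw [Finset.smul_sum]
  exact Finset.sum_congr rfl fun n _ => smul_comm _ _ _

end

/-! ### Taylor expansion of the Gaussian kernels -/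

theorem norm_fourier_gaussian (n : ℕ) (t u : ℝ) :
    ‖(2 * Complex.I * u) ^ n * (Complex.exp (Complex.I * ((2 * t : ℝ) : ℂ) * u) *
      Complex.exp (-1 * (u : ℂ) ^ 2))‖ = Real.exp (-1 * u ^ 2) * ‖(2 * u) ^ n‖ := by
  rw [norm_mul, norm_mul, norm_pow, norm_pow, mul_comm (‖_‖ ^ n), Complex.norm_exp,
    Complex.norm_exp]
  simp [← Complex.ofReal_pow]

theorem integrable_fourier_gaussian (n : ℕ) (t : ℝ) :
    Integrable fun u : ℝ => (2 * Complex.I * u) ^ n *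
      (Complex.exp (Complex.I * ((2 * t : ℝ) : ℂ) * u) * Complex.exp (-1 * (u : ℂ) ^ 2)) :=
  (((ExpGrowth.const 2).mul ExpGrowth.id).pow n).integrable_of_le
    (Continuous.aestronglyMeasurable (by fun_prop)) one_pos
    fun u => (norm_fourier_gaussian n t u).le

/-- The Fourier representation of the derivatives of the Gaussian. -/
theorem integral_fourier_gaussian (n : ℕ) (t : ℝ) :
    ∫ u : ℝ, (2 * Complex.I * u) ^ n *
      (Complex.exp (Complex.I * ((2 * t : ℝ) : ℂ) * u) * Complex.exp (-1 * (u : ℂ) ^ 2)) =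
      ((√Real.pi * iteratedDeriv n (fun s : ℝ => Real.exp (-s ^ 2)) t : ℝ) : ℂ) := by
  induction n generalizing t with
  | zero =>
    have h := fourierIntegral_gaussian (b := 1) (by simp) ((2 * t : ℝ) : ℂ)
    simp only [pow_zero, one_mul, iteratedDeriv_zero]
    rw [h, Real.sqrt_eq_rpow]
    push_cast
    rw [Complex.ofReal_cpow Real.pi_pos.le]
    push_cast
    rw [div_one]
    congr 2
    ring
  | succ n ih =>
    have h1 := ((hasDerivAt_iteratedDeriv_gaussian n t).const_mul √Real.pi).ofReal_comp
    have h2 : HasDerivAt (fun t : ℝ => ∫ u : ℝ, (2 * Complex.I * u) ^ n *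
        (Complex.exp (Complex.I * ((2 * t : ℝ) : ℂ) * u) * Complex.exp (-1 * (u : ℂ) ^ 2)))
        (∫ u : ℝ, (2 * Complex.I * u) ^ (n + 1) *
          (Complex.exp (Complex.I * ((2 * t : ℝ) : ℂ) * u) * Complex.exp (-1 * (u : ℂ) ^ 2)))
        t := by
      refine (hasDerivAt_integral_of_dominated_loc_of_deriv_le
        (F := fun (t u : ℝ) => (2 * Complex.I * u) ^ n *
          (Complex.exp (Complex.I * ((2 * t : ℝ) : ℂ) * u) * Complex.exp (-1 * (u : ℂ) ^ 2)))
        (F' := fun (t u : ℝ) => (2 * Complex.I * u) ^ (n + 1) *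
          (Complex.exp (Complex.I * ((2 * t : ℝ) : ℂ) * u) * Complex.exp (-1 * (u : ℂ) ^ 2)))
        (bound := fun u => Real.exp (-1 * u ^ 2) * ‖(2 * u) ^ (n + 1)‖)
        univ_mem (Eventually.of_forall fun t => Continuous.aestronglyMeasurable (by fun_prop))
        (integrable_fourier_gaussian n t) (Continuous.aestronglyMeasurable (by fun_prop))
        (Eventually.of_forall fun u t _ => (norm_fourier_gaussian (n + 1) t u).le) ?_
        (Eventually.of_forall fun u t _ => ?_)).2
      · exact (((ExpGrowth.const 2).mul ExpGrowth.id).pow (n + 1)).norm.integrable_gaussian_smul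
          (by fun_prop) one_pos
      · have h3 : HasDerivAt (fun t : ℝ => ((2 * t : ℝ) : ℂ)) ((2 * 1 : ℝ) : ℂ) t :=
          ((hasDerivAt_id t).const_mul (2 : ℝ)).ofReal_comp
        refine ((((h3.const_mul Complex.I).mul_const (u : ℂ)).cexp.mul_const
          (Complex.exp (-1 * (u : ℂ) ^ 2))).const_mul ((2 * Complex.I * u) ^ n)).congr_deriv ?_
        push_cast
        ring
    rw [funext ih] at h2
    exact h2.unique h1

theorem integral_fourier_gaussian_even (n : ℕ) (t : ℝ) :
    ∫ u : ℝ, (2 * Complex.I * u) ^ (2 * n) *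
      (Complex.exp (Complex.I * ((2 * t : ℝ) : ℂ) * u) * Complex.exp (-1 * (u : ℂ) ^ 2)) =
      ((√Real.pi * (Real.exp (-t ^ 2) * hermiteH (2 * n) t) : ℝ) : ℂ) := by
  rw [integral_fourier_gaussian, exp_mul_hermiteH, pow_mul, neg_one_sq, one_pow, one_mul]

/-- Since `(2iu)^{2n} = 4^n (-u²)^n`, the series sums under the Fourier integral to `e^{-wu²}`,
leaving a Gaussian of parameter `1 + w`. The majorant `e^{-(1-|w|)u²}` is integrable because `|w| <
1`. -/
theorem hasSum_hermite_even {w : ℂ} (hw : ‖w‖ < 1) (t : ℝ) :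
    HasSum (fun n : ℕ => (1 / (2 ^ (2 * n) * (n ! : ℂ))) * w ^ n *
      ((√Real.pi * (Real.exp (-t ^ 2) * hermiteH (2 * n) t) : ℝ) : ℂ))
      ((Real.pi / (1 + w)) ^ (1 / 2 : ℂ) * Complex.exp (-(t : ℂ) ^ 2 / (1 + w))) := by
  have hb : 0 < (1 + w).re := by
    have := (abs_lt.1 ((Complex.abs_re_le_norm w).trans_lt hw)).1
    simp only [Complex.add_re, Complex.one_re]
    linarith
  have hfg := fourierIntegral_gaussian hb ((2 * t : ℝ) : ℂ)
  rw [show -(((2 * t : ℝ) : ℂ)) ^ 2 / (4 * (1 + w)) = -(t : ℂ) ^ 2 / (1 + w) by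
    push_cast
    rw [show -(2 * (t : ℂ)) ^ 2 = 4 * (-(t : ℂ) ^ 2) by ring,
      mul_div_mul_left _ _ (by norm_num : (4 : ℂ) ≠ 0)]] at hfg
  rw [← hfg]
  simp only [← integral_fourier_gaussian_even, ← integral_const_mul]
  have hterm : ∀ (n : ℕ) (u : ℝ), 1 / (2 ^ (2 * n) * (n ! : ℂ)) * w ^ n *
      ((2 * Complex.I * u) ^ (2 * n) *
        (Complex.exp (Complex.I * ((2 * t : ℝ) : ℂ) * u) * Complex.exp (-1 * (u : ℂ) ^ 2))) =
      (-w * u ^ 2) ^ n / (n ! : ℂ) *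
        (Complex.exp (Complex.I * ((2 * t : ℝ) : ℂ) * u) * Complex.exp (-1 * (u : ℂ) ^ 2)) := by
    intro n u
    have h1 : (2 * Complex.I * u) ^ (2 * n) = 2 ^ (2 * n) * (-(u : ℂ) ^ 2) ^ n := by
      rw [pow_mul, pow_mul, ← mul_pow]
      congr 1
      rw [mul_pow, mul_pow, Complex.I_sq]
      ring
    have h2 : (-w * (u : ℂ) ^ 2) ^ n = w ^ n * (-(u : ℂ) ^ 2) ^ n := by
      rw [← mul_pow]
      congr 1
      ring
    rw [h1, h2]
    have : (n ! : ℂ) ≠ 0 := Nat.cast_ne_zero.2 n.factorial_ne_zero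
    field_simp
  simp only [hterm]
  have hexp : ∀ u : ℝ, HasSum (fun n : ℕ => (‖w‖ * u ^ 2) ^ n / (n ! : ℝ) * Real.exp (-1 * u ^ 2))
      (Real.exp (-(1 - ‖w‖) * u ^ 2)) := by
    intro u
    have h := (NormedSpace.expSeries_div_hasSum_exp (‖w‖ * u ^ 2)).mul_right (Real.exp (-1 * u ^ 2))
    rw [← Real.exp_eq_exp_ℝ, ← Real.exp_add,
      show ‖w‖ * u ^ 2 + -1 * u ^ 2 = -(1 - ‖w‖) * u ^ 2 by ring] at h
    exact h
  refine hasSum_integral_of_dominated_convergence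
    (fun (n : ℕ) (u : ℝ) => (‖w‖ * u ^ 2) ^ n / (n ! : ℝ) * Real.exp (-1 * u ^ 2))
    (fun n => Continuous.aestronglyMeasurable (by fun_prop))
    (fun n => Eventually.of_forall fun u => le_of_eq ?_)
    (Eventually.of_forall fun u => (hexp u).summable) ?_ (Eventually.of_forall fun u => ?_)
  · have := norm_fourier_gaussian 0 t u
    simp only [pow_zero, one_mul, norm_one, mul_one] at this
    rw [norm_mul, this, norm_div, norm_pow, norm_mul, norm_neg, norm_pow, Complex.norm_real,
      Real.norm_eq_abs, sq_abs, Complex.norm_natCast]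
  · simp only [fun u => (hexp u).tsum_eq]
    exact integrable_exp_neg_mul_sq (by linarith)
  · have h := (NormedSpace.expSeries_div_hasSum_exp (-w * (u : ℂ) ^ 2)).mul_right
      (Complex.exp (Complex.I * ((2 * t : ℝ) : ℂ) * u) * Complex.exp (-1 * (u : ℂ) ^ 2))
    rwa [← Complex.exp_eq_exp_ℂ, mul_left_comm (Complex.exp (-w * (u : ℂ) ^ 2)),
      ← Complex.exp_add (-w * (u : ℂ) ^ 2),
      show -w * (u : ℂ) ^ 2 + -1 * (u : ℂ) ^ 2 = -(1 + w) * (u : ℂ) ^ 2 by ring] at h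

/-- The positive factor `π²` splits off the logarithm, and `Re z > 0` keeps `4πz` off the branch
cut, so inversion commutes with the root. -/
theorem cpow_half_pi_div {z : ℂ} (hz : 0 < z.re) :
    ((Real.pi : ℂ) / (4 * z)) ^ (1 / 2 : ℂ) =
      Real.pi * ((4 * (Real.pi : ℂ) * z) ^ (1 / 2 : ℂ))⁻¹ := by
  have hz0 : z ≠ 0 := fun h => by simp [h] at hz
  have hπ : (Real.pi : ℂ) ≠ 0 := Complex.ofReal_ne_zero.2 Real.pi_ne_zero
  have hπ2 : 0 < Real.pi ^ 2 := by positivity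
  have hb0 : 4 * (Real.pi : ℂ) * z ≠ 0 := by simp [hπ, hz0]
  have hre : 0 < (4 * (Real.pi : ℂ) * z).re := by
    rw [show 4 * (Real.pi : ℂ) * z = ((4 * Real.pi : ℝ) : ℂ) * z by push_cast; ring,
      Complex.re_ofReal_mul]
    positivity
  have harg : (4 * (Real.pi : ℂ) * z).arg ≠ Real.pi := fun h => by
    have := (Complex.arg_eq_pi_iff.1 h).1
    linarith
  rw [show (Real.pi : ℂ) / (4 * z) = ((Real.pi ^ 2 : ℝ) : ℂ) * (4 * (Real.pi : ℂ) * z)⁻¹ by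
      push_cast
      field_simp,
    Complex.cpow_def_of_ne_zero (mul_ne_zero (by exact_mod_cast hπ2.ne') (inv_ne_zero hb0)),
    Complex.log_ofReal_mul hπ2 (inv_ne_zero hb0), add_mul, Complex.exp_add,
    ← Complex.inv_cpow _ _ harg,
    Complex.cpow_def_of_ne_zero (inv_ne_zero hb0)]
  congr 1
  rw [Real.log_pow, show (((2 : ℕ) * Real.log Real.pi : ℝ) : ℂ) * (1 / 2) =
    ((Real.log Real.pi : ℝ) : ℂ) by push_cast; ring, ← Complex.ofReal_exp,
    Real.exp_log Real.pi_pos]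

theorem factorial_two_mul_le (n : ℕ) : (2 * n)! ≤ 4 ^ n * n ! ^ 2 := by
  induction n with
  | zero => simp
  | succ n ih =>
    rw [show 2 * (n + 1) = 2 * n + 1 + 1 by ring, Nat.factorial_succ, Nat.factorial_succ,
      Nat.factorial_succ n]
    calc (2 * n + 1 + 1) * ((2 * n + 1) * (2 * n)!)
        ≤ (2 * n + 1 + 1) * ((2 * n + 1 + 1) * (4 ^ n * n ! ^ 2)) := by gcongr; omega
      _ = 4 ^ (n + 1) * ((n + 1) * n !) ^ 2 := by ring

/-- The right side is exactly the denominator of the series in (iii), so its terms become geometric.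
-/
theorem sqrt_two_pow_mul_factorial_even_le (n : ℕ) :
    √(2 ^ (2 * n) * ((2 * n)! : ℝ)) ≤ 2 ^ (2 * n) * (n ! : ℝ) := by
  rw [Real.sqrt_le_left (by positivity), mul_pow, sq (2 ^ (2 * n)), mul_assoc]
  gcongr
  have := factorial_two_mul_le n
  rw [pow_mul]
  norm_num
  exact_mod_cast this

/-! ### The power series of the Gaussian family. -/

namespace C0Group

variable {X : Type*} [NormedAddCommGroup X] [NormedSpace ℂ X]

theorem hasSum_gauss [CompleteSpace X] (T : C0Group X)
    (hT : BddAbove (Set.range fun t : ℝ => ‖T.op t‖)) {z : ℂ} (hz : ‖z - 1 / 4‖ < 1 / 4) (x : X) :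
    HasSum (fun n : ℕ => ((1 / (2 ^ (2 * n) * (n ! : ℂ))) * (4 * z - 1) ^ n) •
      (√Real.pi)⁻¹ • T.hermiteIntegral (2 * n) x) (T.gauss z x) := by
  obtain ⟨M, hM⟩ := hT
  replace hM : ∀ t, ‖T.op t‖ ≤ M := fun t => hM ⟨t, rfl⟩
  have hM0 : 0 ≤ M := (norm_nonneg _).trans (hM 0)
  set w := 4 * z - 1 with hw_def
  have hw : ‖w‖ < 1 := by
    rw [show w = 4 * (z - 1 / 4) by rw [hw_def]; ring, norm_mul]
    norm_num at hz ⊢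
    linarith
  have hzre : 0 < z.re := by
    have := (abs_lt.1 ((Complex.abs_re_le_norm w).trans_lt hw)).1
    simp [hw_def] at this
    linarith
  have h1w : 1 + w = 4 * z := by rw [hw_def]; ring
  set c : ℕ → ℂ := fun n => 1 / (2 ^ (2 * n) * (n ! : ℂ)) * w ^ n * ((√Real.pi)⁻¹ : ℝ)
  have hcn : ∀ n, ‖c n‖ = ‖w‖ ^ n / (2 ^ (2 * n) * (n ! : ℝ)) * (√Real.pi)⁻¹ := fun n => by
    simp only [c]
    rw [norm_mul, norm_mul, norm_pow, Complex.norm_real, Real.norm_of_nonneg (by positivity),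
      norm_div, norm_mul, norm_pow, norm_one, Complex.norm_natCast, Complex.norm_ofNat]
    ring
  set F : ℕ → ℝ → X := fun n t => c n • (Real.exp (-t ^ 2) * hermiteH (2 * n) t) • T.op t x
  have hFi : ∀ n, Integrable (F n) := fun n => (T.integrable_hermiteIntegral (2 * n) x).smul _
  have hFn : ∀ n, ∫ t, ‖F n t‖ ≤ ‖w‖ ^ n * (M * ‖x‖) := by
    intro n
    have hi : Integrable fun t => Real.exp (-t ^ 2) * hermiteH (2 * n) t :=
      (expGrowth_hermiteH _).integrable_gaussian_mul (continuous_hermiteH _)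
    have hπ : 0 < √Real.pi := Real.sqrt_pos.2 Real.pi_pos
    calc ∫ t, ‖F n t‖
        ≤ ∫ t, ‖c n‖ * (|Real.exp (-t ^ 2) * hermiteH (2 * n) t| * (M * ‖x‖)) := by
          refine integral_mono (hFi n).norm ((hi.abs.mul_const _).const_mul _) fun t => ?_
          simp only [F]
          rw [norm_smul, norm_smul, Real.norm_eq_abs]
          gcongr
          exact (T.op t).le_of_opNorm_le (hM t) x
      _ = ‖c n‖ * ((∫ t, |Real.exp (-t ^ 2) * hermiteH (2 * n) t|) * (M * ‖x‖)) := by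
          rw [integral_const_mul, integral_mul_const]
      _ ≤ ‖c n‖ * ((√Real.pi * (2 ^ (2 * n) * (n ! : ℝ))) * (M * ‖x‖)) := by
          gcongr
          refine (integral_abs_exp_mul_hermiteH_le _).trans ?_
          gcongr
          exact sqrt_two_pow_mul_factorial_even_le n
      _ = ‖w‖ ^ n * (M * ‖x‖) := by
          rw [hcn]
          field_simp
  have key := hasSum_integral_of_summable_integral_norm hFi
    (Summable.of_nonneg_of_le (fun n => integral_nonneg fun t => norm_nonneg _) hFn
      ((summable_geometric_of_lt_one (norm_nonneg w) hw).mul_right _))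
  convert key using 1
  · ext n
    simp only [F, c]
    rw [integral_smul, mul_smul _ (((√Real.pi)⁻¹ : ℝ) : ℂ), Complex.coe_smul]
    rfl
  · rw [gauss, ← integral_smul]
    congr 1 with t
    -- The scalar series carries `√π` and the coefficients `c n` carry `1/√π`; dividing by `π`
    -- reconciles them.
    have hs := (hasSum_hermite_even hw t).mul_right ((Real.pi : ℂ)⁻¹)
    rw [h1w, cpow_half_pi_div hzre] at hs
    have hs' := hs.smul_const (T.op t x)
    have hπ : (Real.pi : ℂ) ≠ 0 := Complex.ofReal_ne_zero.2 Real.pi_ne_zero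
    rw [show (Real.pi : ℂ) * ((4 * (Real.pi : ℂ) * z) ^ (1 / 2 : ℂ))⁻¹ *
        Complex.exp (-(t : ℂ) ^ 2 / (4 * z)) * (Real.pi : ℂ)⁻¹ =
        ((4 * (Real.pi : ℂ) * z) ^ (1 / 2 : ℂ))⁻¹ * Complex.exp (-(t : ℂ) ^ 2 / (4 * z)) by
      field_simp, mul_smul] at hs'
    rw [← hs'.tsum_eq]
    congr 1 with n
    simp only [F, c]
    rw [← Complex.coe_smul (Real.exp (-t ^ 2) * hermiteH (2 * n) t), smul_smul]
    congr 1
    have hsq : (√Real.pi : ℂ) * (√Real.pi : ℂ) = Real.pi := by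
      rw [← Complex.ofReal_mul, Real.mul_self_sqrt Real.pi_pos.le]
    have hsn : (√Real.pi : ℂ) ≠ 0 := by
      exact_mod_cast (Real.sqrt_pos.2 Real.pi_pos).ne'
    push_cast
    rw [← hsq]
    field_simp

end C0Group

end

theorem theorem3p1 {X : Type*} [NormedAddCommGroup X] [NormedSpace ℂ X] [CompleteSpace X]
    (T : C0Group X) :
    -- the integral that defines the Gaussian family converges
    (∀ z : ℂ, 0 < z.re → ∀ x : X,
      Integrable (fun t : ℝ => Complex.exp (-(t : ℂ) ^ 2 / (4 * z)) • T.op t x)) ∧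
    -- its value at `1/4` maps into the domain of every power of the generator
    ∃ hdom : ∀ (n : ℕ) (x : X), T.gauss (1 / 4) x ∈ (opPow T.generator n).domain,
      -- (i)
      (∀ (n : ℕ) (x : X),
        Integrable (fun t : ℝ => hermiteh n t • T.op t x) ∧
        ∫ t : ℝ, hermiteh n t • T.op t x =
          (1 / (2 ^ n * (n ! : ℝ))) • opPow T.generator n ⟨T.gauss (1 / 4) x, hdom n x⟩) ∧
      (BddAbove (Set.range fun t : ℝ => ‖T.op t‖) → ∀ (n : ℕ) (x : X),
        ‖opPow T.generator n ⟨T.gauss (1 / 4) x, hdom n x⟩‖ ≤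
          (⨆ t : ℝ, ‖T.op t‖) * √(2 ^ n * (n ! : ℝ)) * ‖x‖) ∧
      -- (ii)
      (∀ x ∈ T.generator.domain, ∀ t : ℝ,
        Tendsto
          (fun m : ℕ => ∑ n ∈ Finset.range (m + 1),
            (1 / (2 ^ n * (n ! : ℝ)) * hermiteH n t) •
              opPow T.generator n ⟨T.gauss (1 / 4) x, hdom n x⟩)
          atTop (𝓝 (T.op t x))) ∧
      -- (iii)
      (BddAbove (Set.range fun t : ℝ => ‖T.op t‖) → ∀ z : ℂ, ‖z - 1 / 4‖ < 1 / 4 → ∀ x : X,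
        HasSum
          (fun n : ℕ => ((1 / (2 ^ (2 * n) * (n ! : ℂ))) * (4 * z - 1) ^ n) •
            opPow T.generator (2 * n) ⟨T.gauss (1 / 4) x, hdom (2 * n) x⟩)
          (T.gauss z x)) := by
  have hpow : ∀ n x h, opPow T.generator n ⟨T.gauss (1 / 4) x, h⟩ =
      (√Real.pi)⁻¹ • T.hermiteIntegral n x := fun n x _ => (T.opPow_gauss n x).choose_spec
  refine ⟨fun z hz x => T.integrable_gauss hz x, fun n x => (T.opPow_gauss n x).choose, ?_⟩
  simp only [hpow]
  refine ⟨fun n x => ⟨T.integrable_hermiteh_smul n x, T.integral_hermiteh_smul n x⟩,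
    fun hT n x => T.norm_hermiteIntegral_le (fun t => le_ciSup hT t) n x, ?_,
    fun hT z hz x => T.hasSum_gauss hT hz x⟩
  rintro x ⟨y, hy⟩ t
  -- Membership in the domain of the generator enters only as differentiability of the orbit at `t`.
  exact tendsto_sum_hermite (T.expGrowth_orbit x) (T.continuous_op x)
    (C0Group.HasGen.hasDerivAt_orbit hy t).differentiableAt
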